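/- For a finite subset $A$ of an abelian group $G$, let $T_3(A)$ be the number of pairs $(x,d)\in G\times G$ with $x,\ x+d,\ x+2d\in A$ (so trivial progressions $d=0$ are counted, and each nontrivial progression is counted once in each direction). Let $M_3(n)$ be the maximum of $T_3(A)$ over all $n$-element sets $A\subseteq\mathbb{Z}$, and let $M_3(n,N)$ be the maximum of $T_3(A)$ over all $n$-element sets $A\subseteq\mathbb{Z}/N\mathbb{Z}$. For integers $k,m\ge 0$ put \[ E(k,m)=\{-k-2m,\dots,-k-4,-k-2\}\cup\{-k,-k+1,\dots,k-1,k\}\cup\{k+2,k+4,\dots,k+2m\},\] \[ F(k,m)=E(k,m)\setminus\{-k-2m\}.\] Theorem. There is an absolute constant $c>0$ with the following property. If $n\ge 0$ is an integer, $N$ is a prime and $n\le cN$, then \[ M_3(n,N)=M_3(n)=\lceil n^2/2\rceil .\] Furthermore, a set $A\subseteq\mathbb{Z}/N\mathbb{Z}$ with $|A|=n$ satisfies $T_3(A)=M_3(n,N)$ if and only if $A$ is an affine image of some $E(k,m)$ or $F(k,m)$ with $k,m\ge 0$, that is, $A=\{as+b \bmod N : s\in S\}$ where $S=E(k,m)$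 or $S=F(k,m)$, and $a,b\in\mathbb{Z}/N\mathbb{Z}$ with $a$ invertible. -/

import Mathlib

/-- `T3 A` is the number of pairs `(x, d)` in `G × G` with `x, x + d, x + 2d ∈ A`. Trivial
progressions (`d = 0`) are counted, and each nontrivial progression is counted in both directions. -/
noncomputable def T3 {G : Type*} [AddCommGroup G] (A : Finset G) : ℕ :=
  Set.ncard {p : G × G | p.1 ∈ A ∧ p.1 + p.2 ∈ A ∧ p.1 + 2 • p.2 ∈ A}

theorem T3_set_finite {G : Type*} [AddCommGroup G] (A : Finset G) :
    {p : G × G | p.1 ∈ A ∧ p.1 + p.2 ∈ A ∧ p.1 + 2 • p.2 ∈ A}.Finite := by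
  refine Set.Finite.of_finite_image (f := fun p : G × G => (p.1, p.1 + p.2)) ?_ ?_
  · refine Set.Finite.subset (A.finite_toSet.prod A.finite_toSet) ?_
    rintro _ ⟨p, hp, rfl⟩
    exact ⟨hp.1, hp.2.1⟩
  · rintro ⟨x, d⟩ _ ⟨x', d'⟩ _ h
    simp only [Prod.mk.injEq] at h
    obtain ⟨h1, h2⟩ := h
    subst h1
    simpa using h2

theorem T3_le {G : Type*} [AddCommGroup G] (A : Finset G) : T3 A ≤ A.card * A.card := by
  have h : T3 A ≤ Set.ncard ((A ×ˢ A : Finset (G × G)) : Set (G × G)) := by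
    refine Set.ncard_le_ncard_of_injOn (fun p : G × G => (p.1, p.1 + p.2)) ?_ ?_
      (Finset.finite_toSet _)
    · intro p hp
      simpa using ⟨hp.1, hp.2.1⟩
    · rintro ⟨x, d⟩ _ ⟨x', d'⟩ _ h
      simp only [Prod.mk.injEq] at h
      obtain ⟨h1, h2⟩ := h
      subst h1
      simpa using h2
  rwa [Set.ncard_coe_finset, Finset.card_product] at h

/-- `M3 G n` is the maximum of `T3 A` over the `n`-element subsets `A` of `G`. It is a true maximum
as soon as `G` has an `n`-element subset, see `M3_isGreatest`. -/
noncomputable def M3 (G : Type*) [AddCommGroup G] (n : ℕ) : ℕ :=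
  sSup {t : ℕ | ∃ A : Finset G, A.card = n ∧ T3 A = t}

theorem M3_isGreatest {G : Type*} [AddCommGroup G] {n : ℕ} (h : ∃ A : Finset G, A.card = n) :
    IsGreatest {t : ℕ | ∃ A : Finset G, A.card = n ∧ T3 A = t} (M3 G n) := by
  have hb : BddAbove {t : ℕ | ∃ A : Finset G, A.card = n ∧ T3 A = t} := by
    refine ⟨n * n, ?_⟩
    rintro _ ⟨A, rfl, rfl⟩
    exact T3_le A
  obtain ⟨A, hA⟩ := h
  exact ⟨Nat.sSup_mem ⟨T3 A, A, hA, rfl⟩ hb, fun t ht => le_csSup hb ht⟩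

/-- `E(k,m) = {-k-2m, …, -k-4, -k-2, -k, -k+1, …, k-1, k, k+2, k+4, …, k+2m}`. -/
noncomputable def extremalE (k m : ℕ) : Finset ℤ :=
  (Finset.Icc 1 m).image (fun i : ℕ => -(k : ℤ) - 2 * (i : ℤ)) ∪
    Finset.Icc (-(k : ℤ)) (k : ℤ) ∪
    (Finset.Icc 1 m).image (fun i : ℕ => (k : ℤ) + 2 * (i : ℤ))

/-- `F(k,m) = {-k-2m+2, …, -k-2, -k, -k+1, …, k-1, k, k+2, …, k+2m}`, which is `E(k,m)` without
its least element `-k-2m`; for `m = 0` this reads `F(k,0) = {-k+1, …, k}`. -/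
noncomputable def extremalF (k m : ℕ) : Finset ℤ :=
  (extremalE k m).erase (-(k : ℤ) - 2 * (m : ℤ))

theorem extremalF_succ (k m : ℕ) : extremalF k (m + 1) =
    (Finset.Icc 1 m).image (fun i : ℕ => -(k : ℤ) - 2 * (i : ℤ)) ∪
      Finset.Icc (-(k : ℤ)) (k : ℤ) ∪
      (Finset.Icc 1 (m + 1)).image (fun i : ℕ => (k : ℤ) + 2 * (i : ℤ)) := by
  ext x
  simp only [extremalF, extremalE, Finset.mem_erase, Finset.mem_union, Finset.mem_image,
    Finset.mem_Icc]
  constructor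
  · rintro ⟨hx, (⟨i, hi, rfl⟩ | h) | h⟩
    · refine Or.inl (Or.inl ⟨i, ⟨hi.1, ?_⟩, rfl⟩)
      by_contra hc
      have : i = m + 1 := by omega
      subst this
      exact hx rfl
    · exact Or.inl (Or.inr h)
    · exact Or.inr h
  · rintro ((⟨i, hi, rfl⟩ | h) | h)
    · refine ⟨by push_cast; omega, Or.inl (Or.inl ⟨i, ⟨hi.1, by omega⟩, rfl⟩)⟩
    · exact ⟨by push_cast; omega, Or.inl (Or.inr h)⟩
    · refine ⟨?_, Or.inr h⟩
      obtain ⟨i, hi, rfl⟩ := h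
      push_cast
      omega

/-- `A ⊆ ℤ/Nℤ` is an affine image of the set of integers `S`: it is the image of `S` under
`x ↦ a x + b mod N` for some invertible `a` and some `b`. -/
def IsAffineImage {N : ℕ} (A : Finset (ZMod N)) (S : Finset ℤ) : Prop :=
  ∃ a b : ZMod N, IsUnit a ∧ A = S.image (fun x : ℤ => a * (x : ZMod N) + b)

open Finset

/-! In ℤ, a progression is determined by its middle `y` and one end, so at most `1 + 2 * min(#below,
#above)` progressions have middle `y`; summing over the ranks of the elements gives `⌈n²/2⌉`.
Equality forces every `y` to reflect its shorter side into the set (`ReflectsShortSide`). Apply this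
at a median and at its right neighbour, at distance `a`: the set `U` of distances to the right of
the median is closed under `u ↦ |u - 2a|` for `u ≥ a`. Hence `U` is `a` times an initial interval
followed by a tail of step two (`exists_dilate_of_reflects_min`), which is half of some `E` or `F`.

In ℤ/Nℤ the task is to show that a sparse set `A` with `T3 A ≥ n²/2` is Freiman isomorphic to a set
of integers; the integer theorem then gives both the bound and the extremal sets. Strong induction
supplies the bound for all proper subsets of `A`, and this keeps `A` from splitting into weakly
interacting pieces.

A Balog–Szemerédi–Gowers argument finds a positive proportion `B` of `A` with small difference set
(`exists_subset_card_sub_le`). By Plünnecke–Ruzsa and Ruzsa covering, the sumsets `kB` grow only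
polynomially in `k`, so high moments of the exponential sum of a sparse `B` force a nonzero
frequency where that sum is nearly `#B` (`exists_norm_expSum_ge`). Half of `B` therefore lies on a
very short arc after dilation.

This piece is then grown. While at least 1% of `A` is missing from the piece `U`, the bounds for `U`
and `A \ U` fall short of `n²/2` by about `#U * #(A \ U)`. So there are many mixed progressions, and
a fixed proportion of `A` lies outside `U` in a set of the form `x - U`, `(x + U) / 2` or `2U - x`
(`exists_subset_affine_copy`). After boundedly many rounds 99% of `A` is covered by boundedly many
short arcs, and Dirichlet approximation dilates them all close to zero (`exists_concentrated`). The
remaining elements take part in too few progressions to pay for their presence, so all of `A` lies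
on an arc shorter than half the circle (`exists_dilate_subset_arc`), where equations `x + z = 2y`
lift to ℤ. -/

/-- The three-term progressions `(x, y, z)` in `A`. -/
def apTriples {G : Type*} [AddCommGroup G] [DecidableEq G] (A : Finset G) : Finset (G × G × G) :=
  {t ∈ A ×ˢ A ×ˢ A | t.1 + t.2.2 = t.2.1 + t.2.1}

/-! ### Counting progressions, and invariance under Freiman isomorphisms -/

section Basic
variable {G H : Type*} [AddCommGroup G] [AddCommGroup H]

theorem mem_apTriples [DecidableEq G] {A : Finset G} {x y z : G} :
    (x, y, z) ∈ apTriples A ↔ x ∈ A ∧ y ∈ A ∧ z ∈ A ∧ x + z = y + y := by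
  simp [apTriples, and_assoc]

theorem T3_eq_card_apTriples [DecidableEq G] (A : Finset G) : T3 A = #(apTriples A) := by
  unfold T3
  rw [← Set.ncard_coe_finset]
  refine Set.ncard_congr (fun p _ => (p.1, p.1 + p.2, p.1 + 2 • p.2)) ?_ ?_ ?_
  · rintro ⟨x, d⟩ ⟨h1, h2, h3⟩
    simp only [mem_coe, mem_apTriples]
    exact ⟨h1, h2, h3, by abel⟩
  · rintro ⟨x, d⟩ ⟨x', d'⟩ _ _ h
    simp only [Prod.mk.injEq] at h
    obtain ⟨rfl, h2, -⟩ := h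
    simpa using h2
  · rintro ⟨x, y, z⟩ h
    simp only [mem_coe, mem_apTriples] at h
    obtain ⟨hx, hy, hz, h⟩ := h
    have hz' : x + 2 • (y - x) = z := by
      rw [two_nsmul, eq_comm, ← sub_eq_zero]
      have : z - (x + (y - x + (y - x))) = x + z - (y + y) := by abel
      rw [this, h, sub_self]
    refine ⟨(x, y - x), ⟨hx, by simpa using hy, ?_⟩, ?_⟩
    · change x + 2 • (y - x) ∈ A
      rwa [hz']
    · simp only [hz', add_sub_cancel]

theorem T3_eq_sum_middle [DecidableEq G] (A : Finset G) :
    T3 A = ∑ y ∈ A, #{x ∈ A | y + y - x ∈ A} := by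
  rw [T3_eq_card_apTriples, card_eq_sum_card_fiberwise (f := fun t => t.2.1) (t := A)]
  · refine sum_congr rfl fun y hy => ?_
    refine card_nbij' (fun t => t.1) (fun x => (x, y, y + y - x)) ?_ ?_ ?_ ?_
    · rintro ⟨x, y', z⟩ h
      simp only [coe_filter, Set.mem_ofPred_eq, mem_apTriples] at h ⊢
      obtain ⟨⟨hx, hy, hz, h⟩, rfl⟩ := h
      exact ⟨hx, by rwa [← h, add_sub_cancel_left]⟩
    · intro x h
      simp only [coe_filter, Set.mem_ofPred_eq, mem_apTriples] at h ⊢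
      exact ⟨⟨h.1, hy, h.2, by abel⟩, trivial⟩
    · rintro ⟨x, y', z⟩ h
      simp only [coe_filter, Set.mem_ofPred_eq, mem_apTriples] at h
      obtain ⟨⟨hx, hy, hz, h⟩, rfl⟩ := h
      simp only [← h, add_sub_cancel_left]
    · intro x _
      rfl
  · rintro ⟨x, y, z⟩ h
    exact (mem_apTriples.1 h).2.1

/-- Freiman isomorphisms of order two preserve the number of progressions. -/
theorem T3_image_of_freiman [DecidableEq H] {A : Finset G} {f : G → H}
    (hf : Set.InjOn f A)
    (h : ∀ x ∈ A, ∀ y ∈ A, ∀ z ∈ A, f x + f z = f y + f y ↔ x + z = y + y) :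
    T3 (A.image f) = T3 A := by
  classical
  rw [T3_eq_card_apTriples, T3_eq_card_apTriples, eq_comm]
  refine card_nbij (fun t => (f t.1, f t.2.1, f t.2.2)) ?_ ?_ ?_
  · rintro ⟨x, y, z⟩ ht
    simp only [mem_coe, mem_apTriples] at ht ⊢
    obtain ⟨hx, hy, hz, e⟩ := ht
    exact ⟨mem_image_of_mem _ hx, mem_image_of_mem _ hy, mem_image_of_mem _ hz,
      (h x hx y hy z hz).2 e⟩
  · rintro ⟨x, y, z⟩ ht ⟨x', y', z'⟩ ht' e
    simp only [mem_coe, mem_apTriples] at ht ht'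
    simp only [Prod.mk.injEq] at e
    rw [hf ht.1 ht'.1 e.1, hf ht.2.1 ht'.2.1 e.2.1, hf ht.2.2.1 ht'.2.2.1 e.2.2]
  · rintro ⟨x, y, z⟩ ht
    simp only [mem_coe, mem_apTriples, mem_image] at ht
    obtain ⟨⟨x, hx, rfl⟩, ⟨y, hy, rfl⟩, ⟨z, hz, rfl⟩, e⟩ := ht
    exact ⟨(x, y, z), mem_apTriples.2 ⟨hx, hy, hz, (h x hx y hy z hz).1 e⟩, rfl⟩

theorem T3_image_affine {R : Type*} [CommRing R] [IsDomain R] [DecidableEq R] (A : Finset R)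
    {a : R} (ha : a ≠ 0) (b : R) : T3 (A.image fun x => a * x + b) = T3 A := by
  refine T3_image_of_freiman (fun x _ y _ h => ?_) (fun x _ y _ z _ => ?_)
  · simpa [ha] using h
  · rw [← mul_right_inj' (a := a) ha (b := x + z)]
    constructor <;> intro h <;> linear_combination h

theorem card_image_affine {R : Type*} [CommRing R] [IsDomain R] [DecidableEq R] (A : Finset R)
    {a : R} (ha : a ≠ 0) (b : R) : #(A.image fun x => a * x + b) = #A :=
  card_image_of_injective _ fun x y h => by simpa [ha] using h

end Basic

/-! ### The sharp bound in the integers -/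

section Integers

/-- The middle `y` of a progression in `S` determines it up to its first element `x`; the number of
such `x` is odd and is counted on either side of `y`. -/
theorem card_middle_eq_lower {S : Finset ℤ} {y : ℤ} (hy : y ∈ S) :
    #{x ∈ S | y + y - x ∈ S} = 1 + 2 * #{x ∈ S | x < y ∧ y + y - x ∈ S} := by
  have h1 : {x ∈ S | y + y - x ∈ S} = insert y ({x ∈ S | x < y ∧ y + y - x ∈ S} ∪
      {x ∈ S | x < y ∧ y + y - x ∈ S}.image fun x => y + y - x) := by
    ext x
    simp only [mem_filter, mem_insert, mem_union, mem_image]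
    constructor
    · rintro ⟨hx, hx'⟩
      rcases lt_trichotomy x y with h | h | h
      · exact Or.inr (Or.inl ⟨hx, h, hx'⟩)
      · exact Or.inl h
      · exact Or.inr (Or.inr ⟨y + y - x, ⟨hx', by omega, by simpa using hx⟩, by omega⟩)
    · rintro (rfl | ⟨hx, -, hx'⟩ | ⟨z, ⟨hz, -, hz'⟩, rfl⟩)
      · exact ⟨hy, by simpa using hy⟩
      · exact ⟨hx, hx'⟩
      · exact ⟨hz', by simpa using hz⟩
  rw [h1, card_insert_of_notMem, card_union_of_disjoint, card_image_of_injective]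
  · ring
  · intro a b h
    simpa using h
  · rw [disjoint_left]
    simp only [mem_filter, mem_image, not_exists, not_and]
    rintro x ⟨-, hx, -⟩ z ⟨-, hz, -⟩ h
    omega
  · simp only [mem_filter, mem_union, mem_image, not_or, not_exists, not_and]
    exact ⟨fun _ h => absurd h (lt_irrefl _), fun z hz h => by omega⟩

theorem card_middle_eq_upper {S : Finset ℤ} {y : ℤ} (hy : y ∈ S) :
    #{x ∈ S | y + y - x ∈ S} = 1 + 2 * #{x ∈ S | y < x ∧ y + y - x ∈ S} := by
  rw [card_middle_eq_lower hy]
  congr 2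
  refine card_nbij' (fun x => y + y - x) (fun x => y + y - x) ?_ ?_ ?_ ?_
  · intro x hx
    simp only [coe_filter, Set.mem_ofPred_eq] at hx ⊢
    exact ⟨hx.2.2, by omega, by simpa using hx.1⟩
  · intro x hx
    simp only [coe_filter, Set.mem_ofPred_eq] at hx ⊢
    exact ⟨hx.2.2, by omega, by simpa using hx.1⟩
  · intro x _
    simp
  · intro x _
    simp

theorem card_lower_add_card_upper {S : Finset ℤ} {y : ℤ} (hy : y ∈ S) :
    #{x ∈ S | x < y} + #{x ∈ S | y < x} + 1 = #S := by
  rw [← card_union_of_disjoint, ← card_erase_add_one hy]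
  · congr 2
    ext x
    simp only [mem_union, mem_filter, mem_erase]
    constructor
    · rintro (h | h)
      · exact ⟨by omega, h.1⟩
      · exact ⟨by omega, h.1⟩
    · rintro ⟨h, hx⟩
      rcases lt_or_gt_of_ne h with h | h
      · exact Or.inl ⟨hx, h⟩
      · exact Or.inr ⟨hx, h⟩
  · rw [disjoint_left]
    simp only [mem_filter, not_and]
    intro x hx _
    omega

theorem card_lower_injOn (S : Finset ℤ) : Set.InjOn (fun y : ℤ => #{x ∈ S | x < y}) S := by
  have key : ∀ y ∈ S, ∀ z, y < z → #{x ∈ S | x < y} < #{x ∈ S | x < z} := by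
    intro y hy z h
    refine card_lt_card ⟨fun x hx => ?_, fun hs => ?_⟩
    · simp only [mem_filter] at hx ⊢
      exact ⟨hx.1, by omega⟩
    · have := hs (mem_filter.2 ⟨hy, h⟩)
      simp at this
  intro y hy z hz h
  rcases lt_trichotomy y z with h' | h' | h'
  · exact absurd h (key y hy z h').ne
  · exact h'
  · exact absurd h (key z hz y h').ne'

theorem image_card_lower (S : Finset ℤ) :
    S.image (fun y : ℤ => #{x ∈ S | x < y}) = range #S := by
  refine eq_of_subset_of_card_le (fun i hi => ?_) ?_
  · obtain ⟨y, hy, rfl⟩ := mem_image.1 hi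
    have := card_lower_add_card_upper hy
    exact mem_range.2 (by omega)
  · rw [card_range, card_image_of_injOn (card_lower_injOn S)]

theorem sum_one_add_two_mul_min (n : ℕ) :
    ∑ i ∈ range n, (1 + 2 * min i (n - 1 - i)) = (n ^ 2 + 1) / 2 := by
  induction n using Nat.twoStepInduction with
  | zero => rfl
  | one => rfl
  | more n ih _ =>
    -- Strip both end indices: each contributes 1, and every remaining minimum drops by one.
    rw [sum_range_succ, sum_range_succ']
    have : ∑ i ∈ range n, (1 + 2 * min (i + 1) (n + 2 - 1 - (i + 1))) =
        ∑ i ∈ range n, ((1 + 2 * min i (n - 1 - i)) + 2) := by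
      refine sum_congr rfl fun i hi => ?_
      have := mem_range.1 hi
      omega
    rw [this, sum_add_distrib, ih, sum_const, card_range]
    have e : (n + 2) ^ 2 + 1 = (n ^ 2 + 1) + 2 * (2 * n + 2) := by ring
    rw [e, Nat.add_mul_div_left _ _ two_pos, smul_eq_mul]
    omega

/-- The rank `#{x ∈ S | x < y}` maps `S` bijectively to `range #S`, so the sum depends only on `#S`.
-/
theorem sum_min_lower_upper (S : Finset ℤ) :
    ∑ y ∈ S, (1 + 2 * min #{x ∈ S | x < y} #{x ∈ S | y < x}) = (#S ^ 2 + 1) / 2 := by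
  rw [← sum_one_add_two_mul_min, ← image_card_lower, sum_image (card_lower_injOn S)]
  refine sum_congr rfl fun y hy => ?_
  have := card_lower_add_card_upper hy
  congr 3
  omega

theorem card_middle_le {S : Finset ℤ} {y : ℤ} (hy : y ∈ S) :
    #{x ∈ S | y + y - x ∈ S} ≤ 1 + 2 * min #{x ∈ S | x < y} #{x ∈ S | y < x} := by
  have h1 : #{x ∈ S | x < y ∧ y + y - x ∈ S} ≤ #{x ∈ S | x < y} :=
    card_le_card fun x hx => by
      simp only [mem_filter] at hx ⊢
      exact ⟨hx.1, hx.2.1⟩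
  have h2 : #{x ∈ S | y < x ∧ y + y - x ∈ S} ≤ #{x ∈ S | y < x} :=
    card_le_card fun x hx => by
      simp only [mem_filter] at hx ⊢
      exact ⟨hx.1, hx.2.1⟩
  have h3 := card_middle_eq_lower hy
  have h4 := card_middle_eq_upper hy
  omega

theorem T3_int_le (S : Finset ℤ) : T3 S ≤ (#S ^ 2 + 1) / 2 := by
  rw [T3_eq_sum_middle, ← sum_min_lower_upper]
  exact sum_le_sum fun y hy => card_middle_le hy

/-- Each element has the largest possible number of progressions of which it is the middle. -/
structure ReflectsShortSide (S : Finset ℤ) : Prop where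
  lower : ∀ y ∈ S, #{x ∈ S | x < y} ≤ #{x ∈ S | y < x} → ∀ x ∈ S, x < y → y + y - x ∈ S
  upper : ∀ y ∈ S, #{x ∈ S | y < x} ≤ #{x ∈ S | x < y} → ∀ x ∈ S, y < x → y + y - x ∈ S

theorem reflectsShortSide_of_T3_eq {S : Finset ℤ} (h : T3 S = (#S ^ 2 + 1) / 2) :
    ReflectsShortSide S := by
  rw [T3_eq_sum_middle, ← sum_min_lower_upper,
    sum_eq_sum_iff_of_le fun y hy => card_middle_le hy] at h
  refine ⟨fun y hy hle x hx hxy => ?_, fun y hy hle x hx hxy => ?_⟩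
  · have h1 := h y hy
    rw [card_middle_eq_lower hy, min_eq_left hle] at h1
    have h2 : {x ∈ S | x < y ∧ y + y - x ∈ S} = {x ∈ S | x < y} :=
      eq_of_subset_of_card_le (fun x hx => by
        simp only [mem_filter] at hx ⊢
        exact ⟨hx.1, hx.2.1⟩) (by omega)
    have h3 : x ∈ {x ∈ S | x < y} := mem_filter.2 ⟨hx, hxy⟩
    rw [← h2] at h3
    exact (mem_filter.1 h3).2.2
  · have h1 := h y hy
    rw [card_middle_eq_upper hy, min_eq_right hle] at h1
    have h2 : {x ∈ S | y < x ∧ y + y - x ∈ S} = {x ∈ S | y < x} :=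
      eq_of_subset_of_card_le (fun x hx => by
        simp only [mem_filter] at hx ⊢
        exact ⟨hx.1, hx.2.1⟩) (by omega)
    have h3 : x ∈ {x ∈ S | y < x} := mem_filter.2 ⟨hx, hxy⟩
    rw [← h2] at h3
    exact (mem_filter.1 h3).2.2

/-- If the elements of `S` reflect one side of themselves into `S`, then `T3 S` is maximal. -/
theorem T3_eq_of_reflects {S : Finset ℤ} (h : ∀ y ∈ S,
    (∀ x ∈ S, x < y → y + y - x ∈ S) ∨ (∀ x ∈ S, y < x → y + y - x ∈ S)) :
    T3 S = (#S ^ 2 + 1) / 2 := by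
  refine le_antisymm (T3_int_le S) ?_
  rw [T3_eq_sum_middle, ← sum_min_lower_upper]
  refine sum_le_sum fun y hy => ?_
  rcases h y hy with h | h
  · have : {x ∈ S | x < y ∧ y + y - x ∈ S} = {x ∈ S | x < y} :=
      filter_congr fun x hx => ⟨fun h => h.1, fun hxy => ⟨hxy, h x hx hxy⟩⟩
    rw [card_middle_eq_lower hy, this]
    omega
  · have : {x ∈ S | y < x ∧ y + y - x ∈ S} = {x ∈ S | y < x} :=
      filter_congr fun x hx => ⟨fun h => h.1, fun hxy => ⟨hxy, h x hx hxy⟩⟩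
    rw [card_middle_eq_upper hy, this]
    omega

theorem mem_extremalE {k m : ℕ} {x : ℤ} : x ∈ extremalE k m ↔
    x.natAbs ≤ k ∨ (x.natAbs ≤ k + 2 * m ∧ x.natAbs % 2 = k % 2) := by
  simp only [extremalE, mem_union, mem_image, mem_Icc]
  constructor
  · rintro ((⟨i, hi, rfl⟩ | h) | ⟨i, hi, rfl⟩)
    · right; omega
    · left; omega
    · right; omega
  · intro h
    by_cases hk : x.natAbs ≤ k
    · left; right; omega
    · rcases le_total 0 x with hx | hx
      · right
        exact ⟨(x.natAbs - k) / 2, by omega, by omega⟩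
      · left; left
        exact ⟨(x.natAbs - k) / 2, by omega, by omega⟩

theorem mem_extremalF {k m : ℕ} {x : ℤ} : x ∈ extremalF k m ↔
    x ≠ -(k : ℤ) - 2 * m ∧ (x.natAbs ≤ k ∨ (x.natAbs ≤ k + 2 * m ∧ x.natAbs % 2 = k % 2)) := by
  rw [extremalF, mem_erase, mem_extremalE]

theorem extremalE_reflects (k m : ℕ) : ∀ y ∈ extremalE k m,
    (∀ x ∈ extremalE k m, x < y → y + y - x ∈ extremalE k m) ∨
      (∀ x ∈ extremalE k m, y < x → y + y - x ∈ extremalE k m) := by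
  intro y hy
  simp only [mem_extremalE] at *
  rcases le_total y 0 with h | h
  · left
    intro x hx hxy
    omega
  · right
    intro x hx hxy
    omega

theorem extremalF_reflects (k m : ℕ) : ∀ y ∈ extremalF k m,
    (∀ x ∈ extremalF k m, x < y → y + y - x ∈ extremalF k m) ∨
      (∀ x ∈ extremalF k m, y < x → y + y - x ∈ extremalF k m) := by
  intro y hy
  simp only [mem_extremalF] at *
  -- Here 0 must reflect its left side: its right side contains `k + 2m`, whose mirror image has
  -- been removed.
  rcases le_or_gt y 0 with h | h
  · left
    intro x hx hxy
    omega
  · right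
    intro x hx hxy
    omega

theorem T3_extremalE (k m : ℕ) : T3 (extremalE k m) = (#(extremalE k m) ^ 2 + 1) / 2 :=
  T3_eq_of_reflects (extremalE_reflects k m)

theorem T3_extremalF (k m : ℕ) : T3 (extremalF k m) = (#(extremalF k m) ^ 2 + 1) / 2 :=
  T3_eq_of_reflects (extremalF_reflects k m)

end Integers

/-! ### Extremal sets of integers -/

section IntegerClassification

/-- Let `a` be the least positive element. Descending along `u ↦ |u - 2a|` shows that all elements
are multiples of `a`, and that with `a * (v + 2)` also `a * v` occurs. Thus the multipliers of each
parity form an initial segment. If `k + 1` is the first missing multiplier, every multiplier beyond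
`k` has the parity of `k`. -/
theorem exists_dilate_of_reflects_min {U : Finset ℕ} (h0 : 0 ∈ U)
    (hU : ∀ a ∈ U, 0 < a → (∀ b ∈ U, 0 < b → a ≤ b) →
      ∀ u ∈ U, a ≤ u → ((u : ℤ) - 2 * a).natAbs ∈ U) :
    ∃ a k m : ℕ, 0 < a ∧
      ∀ u, u ∈ U ↔ ∃ v, u = a * v ∧ (v ≤ k ∨ (v ≤ k + 2 * m ∧ v % 2 = k % 2)) := by
  by_cases hne : (U.erase 0).Nonempty
  swap
  · refine ⟨1, 0, 0, one_pos, fun u => ⟨fun hu => ⟨0, ?_, by simp⟩, ?_⟩⟩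
    · by_contra h
      exact hne ⟨u, mem_erase.2 ⟨by simpa using h, hu⟩⟩
    · rintro ⟨v, rfl, h⟩
      have : 1 * v = 0 := by omega
      rwa [this]
  obtain ⟨a, ha, hmin⟩ := (U.erase 0).exists_min_image id hne
  rw [mem_erase] at ha
  have hapos : 0 < a := Nat.pos_of_ne_zero ha.1
  have hmin' : ∀ b ∈ U, 0 < b → a ≤ b := fun b hb hb0 => hmin b (mem_erase.2 ⟨hb0.ne', hb⟩)
  have hcl := hU a ha.2 hapos hmin'
  have hdvd : ∀ u ∈ U, a ∣ u := by
    intro u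
    induction u using Nat.strong_induction_on with
    | _ u ih =>
      intro hu
      rcases Nat.eq_zero_or_pos u with rfl | hpos
      · exact dvd_zero a
      rcases (hmin' u hu hpos).eq_or_lt with rfl | hlt
      · exact dvd_rfl
      have h1 := ih _ (by omega) (hcl u hu hlt.le)
      rw [← Int.natCast_dvd_natCast, Int.dvd_natAbs] at h1
      have h2 : (a : ℤ) ∣ ((u : ℤ) - 2 * a) + 2 * a := dvd_add h1 (dvd_mul_left _ _)
      rw [sub_add_cancel] at h2
      exact_mod_cast h2
  have hstep : ∀ v, a * (v + 2) ∈ U → a * v ∈ U := by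
    intro v hv
    have h1 := hcl _ hv (by nlinarith)
    have h2 : (((a * (v + 2) : ℕ) : ℤ) - 2 * a).natAbs = a * v := by
      have : (((a * (v + 2) : ℕ) : ℤ) - 2 * a) = ((a * v : ℕ) : ℤ) := by push_cast; ring
      rw [this, Int.natAbs_natCast]
    rwa [h2] at h1
  have hdesc : ∀ i v, a * (v + 2 * i) ∈ U → a * v ∈ U := by
    intro i
    induction i with
    | zero => intro v h; exact h
    | succ i ih =>
      intro v h
      exact ih v (hstep _ (by rwa [show v + 2 * i + 2 = v + 2 * (i + 1) by ring]))
  obtain ⟨M, hM, hMmax⟩ := U.exists_max_image id ⟨0, h0⟩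
  obtain ⟨w, rfl⟩ := hdvd M hM
  have hle : ∀ v, a * v ∈ U → v ≤ w := fun v hv => Nat.le_of_mul_le_mul_left (hMmax _ hv) hapos
  have hex : ∃ k, a * (k + 1) ∉ U := ⟨w, fun h => by have := hle _ h; omega⟩
  classical
  let k := Nat.find hex
  have hk : a * (k + 1) ∉ U := Nat.find_spec hex
  have hlt : ∀ v ≤ k, a * v ∈ U := by
    intro v hv
    rcases Nat.eq_zero_or_pos v with rfl | hpos
    · simpa using h0
    · have := Nat.find_min hex (m := v - 1) (by change v - 1 < k; omega)
      rwa [not_not, Nat.sub_add_cancel hpos] at this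
  have hpar : ∀ v, a * v ∈ U → k < v → v % 2 = k % 2 := by
    intro v hv hkv
    by_contra hne
    apply hk
    apply hdesc ((v - (k + 1)) / 2)
    have : k + 1 + 2 * ((v - (k + 1)) / 2) = v := by omega
    rwa [this]
  have hkw : k ≤ w := hle _ (hlt k le_rfl)
  have hw : k = w ∨ w % 2 = k % 2 := by
    rcases hkw.eq_or_lt with h | h
    · exact Or.inl h
    · exact Or.inr (hpar w hM h)
  refine ⟨a, k, (w - k) / 2, hapos, fun u => ⟨fun hu => ?_, ?_⟩⟩
  · obtain ⟨v, rfl⟩ := hdvd u hu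
    refine ⟨v, rfl, ?_⟩
    by_cases hv : v ≤ k
    · exact Or.inl hv
    · refine Or.inr ⟨?_, hpar v hu (by omega)⟩
      have := hle v hu
      omega
  · rintro ⟨v, rfl, hv | ⟨hv, hv'⟩⟩
    · exact hlt v hv
    · apply hdesc ((w - v) / 2)
      have : v + 2 * ((w - v) / 2) = w := by omega
      rwa [this]

/-- The set of distances from `y` to the elements of `S` to the right of `y`. -/
def rightDistances (S : Finset ℤ) (y : ℤ) : Finset ℕ :=
  {x ∈ S | y ≤ x}.image fun x => (x - y).toNat

theorem mem_rightDistances {S : Finset ℤ} {y : ℤ} {t : ℕ} :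
    t ∈ rightDistances S y ↔ y + t ∈ S := by
  simp only [rightDistances, mem_image, mem_filter]
  constructor
  · rintro ⟨x, ⟨hx, hxy⟩, rfl⟩
    rwa [show y + ((x - y).toNat : ℤ) = x by omega]
  · intro h
    exact ⟨y + t, ⟨h, by omega⟩, by omega⟩

/-- An element `y + a` to the right of a median has its shorter side on the right, so it reflects `y
+ u` to `y + 2a - u`. If this falls to the left of `y`, reflecting once more in `y` returns it to
the right, at distance `u - 2a`. -/
theorem rightDistances_reflects_min {S : Finset ℤ} {y : ℤ} (hS : ReflectsShortSide S)
    (hlow : ∀ x ∈ S, x < y → y + y - x ∈ S)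
    (hcard : #{x ∈ S | y < x} ≤ #{x ∈ S | x < y} + 1) (hy : y ∈ S) :
    ∀ a ∈ rightDistances S y, 0 < a → (∀ b ∈ rightDistances S y, 0 < b → a ≤ b) →
      ∀ u ∈ rightDistances S y, a ≤ u → ((u : ℤ) - 2 * a).natAbs ∈ rightDistances S y := by
  intro a ha hapos hmin u hu hau
  simp only [mem_rightDistances] at *
  rcases hau.eq_or_lt with rfl | hlt
  · rwa [show (((a : ℤ) - 2 * a).natAbs : ℤ) = a by omega]
  have hup : #{x ∈ S | y + a < x} + 1 ≤ #{x ∈ S | y < x} := by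
    rw [Nat.succ_le_iff]
    refine card_lt_card ⟨fun x hx => ?_, fun hs => ?_⟩
    · simp only [mem_filter] at hx ⊢
      exact ⟨hx.1, by omega⟩
    · have := hs (mem_filter.2 ⟨ha, by omega⟩)
      simp at this
  have hlo : #{x ∈ S | x < y} ≤ #{x ∈ S | x < y + a} := by
    refine card_le_card fun x hx => ?_
    simp only [mem_filter] at hx ⊢
    exact ⟨hx.1, by omega⟩
  have h := hS.upper _ ha (by omega) _ hu (by omega)
  rcases le_total (2 * a) u with h2 | h2
  · have := hlow _ h
    rcases h2.eq_or_lt with h3 | h3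
    · rw [show y + (((u : ℤ) - 2 * a).natAbs : ℤ) = y by omega]
      exact hy
    · have := this (by omega)
      rwa [show y + (((u : ℤ) - 2 * a).natAbs : ℤ) = y + y - (y + a + (y + a) - (y + u)) by omega]
  · rwa [show y + (((u : ℤ) - 2 * a).natAbs : ℤ) = y + a + (y + a) - (y + u) by omega]

/-- An exact median has two shortest sides, so `S` is symmetric about it and is determined by its
right half. -/
theorem eq_image_extremalE {S : Finset ℤ} {y : ℤ} (hS : ReflectsShortSide S) (hy : y ∈ S)
    (hcard : #{x ∈ S | x < y} = #{x ∈ S | y < x}) :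
    ∃ (k m : ℕ) (a : ℤ), a ≠ 0 ∧ S = (extremalE k m).image fun x => a * x + y := by
  have hlow := hS.lower y hy hcard.le
  have hupp := hS.upper y hy hcard.ge
  obtain ⟨a, k, m, ha, h⟩ := exists_dilate_of_reflects_min
    (mem_rightDistances.2 (by simpa using hy) : 0 ∈ rightDistances S y)
    (rightDistances_reflects_min hS hlow (by omega) hy)
  have hmem : ∀ x, x ∈ S ↔ (x - y).natAbs ∈ rightDistances S y := by
    intro x
    rw [mem_rightDistances]
    rcases lt_trichotomy x y with hx | rfl | hx
    · rw [show y + ((x - y).natAbs : ℤ) = y + y - x by omega]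
      exact ⟨fun h => hlow x h hx, fun h => by simpa using hupp _ h (by omega)⟩
    · simp
    · rw [show y + ((x - y).natAbs : ℤ) = x by omega]
  refine ⟨k, m, a, by omega, ?_⟩
  ext x
  rw [hmem, h, mem_image]
  simp only [mem_extremalE]
  constructor
  · rintro ⟨v, hv, hv'⟩
    rcases le_total y x with hx | hx
    · refine ⟨v, by simpa using hv', ?_⟩
      have : x - y = ((a * v : ℕ) : ℤ) := by omega
      push_cast at this
      omega
    · refine ⟨-v, by simpa using hv', ?_⟩
      have : y - x = ((a * v : ℕ) : ℤ) := by omega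
      push_cast at this
      rw [mul_neg]
      omega
  · rintro ⟨v, hv, rfl⟩
    exact ⟨v.natAbs, by simp [Int.natAbs_mul], hv⟩

/-- The left side of the lower median `y` reflects injectively into the right side, which has one
element more. As the mirror image of the maximum `M` is missing, `M` is the only unmatched element;
it sits at the largest distance `a * (k + 2m)`, which is why the set is an `F`. -/
theorem eq_image_extremalF {S : Finset ℤ} {y M : ℤ} (hS : ReflectsShortSide S) (hy : y ∈ S)
    (hcard : #{x ∈ S | y < x} = #{x ∈ S | x < y} + 1) (hM : M ∈ S) (hMmax : ∀ x ∈ S, x ≤ M)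
    (hM' : y + y - M ∉ S) :
    ∃ (k m : ℕ) (a : ℤ), a ≠ 0 ∧ S = (extremalF k m).image fun x => a * x + y := by
  have hlow := hS.lower y hy (by omega)
  obtain ⟨a, k, m, ha, h⟩ := exists_dilate_of_reflects_min
    (mem_rightDistances.2 (by simpa using hy) : 0 ∈ rightDistances S y)
    (rightDistances_reflects_min hS hlow (by omega) hy)
  have hyM : y < M := by
    refine (hMmax y hy).lt_of_ne ?_
    rintro rfl
    exact hM' (by simpa using hy)
  have hupp : ∀ x ∈ S, y < x → x ≠ M → y + y - x ∈ S := by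
    have h1 : {x ∈ S | x < y}.image (fun x => y + y - x) = {x ∈ S | y < x}.erase M := by
      refine eq_of_subset_of_card_le (fun x hx => ?_) ?_
      · obtain ⟨z, hz, rfl⟩ := mem_image.1 hx
        simp only [mem_filter, mem_erase] at hz ⊢
        refine ⟨?_, hlow z hz.1 hz.2, by omega⟩
        rintro rfl
        exact hM' (by simpa using hz.1)
      · have hM2 : M ∈ ({x ∈ S | y < x} : Finset ℤ) := mem_filter.2 ⟨hM, hyM⟩
        rw [card_erase_of_mem hM2, card_image_of_injective _
          (fun x z h => by simpa using h)]
        omega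
    intro x hx hxy hxM
    have h2 : x ∈ {x ∈ S | y < x}.erase M := by simp [hx, hxy, hxM]
    rw [← h1, mem_image] at h2
    obtain ⟨z, hz, rfl⟩ := h2
    simpa using (mem_filter.1 hz).1
  have hmem : ∀ x, x ∈ S ↔ x ≠ y + y - M ∧ (x - y).natAbs ∈ rightDistances S y := by
    intro x
    rw [mem_rightDistances]
    rcases lt_trichotomy x y with hx | rfl | hx
    · rw [show y + ((x - y).natAbs : ℤ) = y + y - x by omega]
      refine ⟨fun h => ⟨?_, hlow x h hx⟩, fun h => ?_⟩
      · rintro rfl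
        exact hM' h
      · simpa using hupp _ h.2 (by omega) (by omega)
    · simp only [sub_self, Int.natAbs_zero, Nat.cast_zero, add_zero]
      exact ⟨fun h => ⟨by omega, h⟩, fun h => h.2⟩
    · rw [show y + ((x - y).natAbs : ℤ) = x by omega]
      exact ⟨fun h => ⟨by omega, h⟩, fun h => h.2⟩
  have hkm : M - y = a * (k + 2 * m) := by
    apply le_antisymm
    · obtain ⟨v, hv, hv'⟩ := (h (M - y).toNat).1
        (mem_rightDistances.2 (by rwa [show y + ((M - y).toNat : ℤ) = M by omega]))
      have h1 : M - y = ((a * v : ℕ) : ℤ) := by omega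
      have h2 : a * v ≤ a * (k + 2 * m) := Nat.mul_le_mul_left _ (by omega)
      rw [h1]
      exact_mod_cast h2
    · have h1 := hMmax _ (mem_rightDistances.1 ((h (a * (k + 2 * m))).2
        ⟨k + 2 * m, rfl, Or.inr ⟨le_rfl, by omega⟩⟩))
      push_cast at h1
      omega
  have ha' : (a : ℤ) ≠ 0 := by omega
  refine ⟨k, m, a, ha', ?_⟩
  ext x
  rw [hmem, h, mem_image]
  simp only [mem_extremalF]
  have hne : ∀ v : ℤ, a * v + y = y + y - M ↔ v = -(k : ℤ) - 2 * m := by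
    intro v
    rw [← mul_right_inj' ha' (b := v)]
    constructor <;> intro h
    · linear_combination h - hkm
    · linear_combination h + hkm
  constructor
  · rintro ⟨hx, v, hv, hv'⟩
    rcases le_total y x with hyx | hyx
    · have : x - y = ((a * v : ℕ) : ℤ) := by omega
      push_cast at this
      obtain rfl : x = a * v + y := by omega
      exact ⟨v, ⟨fun h => hx ((hne _).2 h), by simpa using hv'⟩, rfl⟩
    · have : y - x = ((a * v : ℕ) : ℤ) := by omega
      push_cast at this
      obtain rfl : x = a * (-v) + y := by rw [mul_neg]; omega
      exact ⟨-v, ⟨fun h => hx ((hne _).2 h), by simpa using hv'⟩, rfl⟩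
  · rintro ⟨v, ⟨hv, hv'⟩, rfl⟩
    exact ⟨fun h => hv ((hne _).1 h), v.natAbs, by simp [Int.natAbs_mul], hv'⟩

theorem ReflectsShortSide.image_neg {S : Finset ℤ} (hS : ReflectsShortSide S) :
    ReflectsShortSide (S.image fun x => -x) := by
  have hlow : ∀ y, #{x ∈ S.image fun x => -x | x < -y} = #{x ∈ S | y < x} := by
    intro y
    rw [filter_image, card_image_of_injective _ neg_injective]
    simp
  have hupp : ∀ y, #{x ∈ S.image fun x => -x | -y < x} = #{x ∈ S | x < y} := by
    intro y
    rw [filter_image, card_image_of_injective _ neg_injective]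
    simp
  constructor
  · intro y hy hle x hx hxy
    obtain ⟨y, hy', rfl⟩ := mem_image.1 hy
    obtain ⟨x, hx', rfl⟩ := mem_image.1 hx
    rw [hlow, hupp] at hle
    exact mem_image.2 ⟨_, hS.upper y hy' hle x hx' (by omega), by ring⟩
  · intro y hy hle x hx hxy
    obtain ⟨y, hy', rfl⟩ := mem_image.1 hy
    obtain ⟨x, hx', rfl⟩ := mem_image.1 hx
    rw [hlow, hupp] at hle
    exact mem_image.2 ⟨_, hS.lower y hy' hle x hx' (by omega), by ring⟩

theorem exists_card_lower_eq {S : Finset ℤ} {i : ℕ} (hi : i < #S) :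
    ∃ y ∈ S, #{x ∈ S | x < y} = i := by
  have : i ∈ S.image (fun y : ℤ => #{x ∈ S | x < y}) := by
    rw [image_card_lower]
    exact mem_range.2 hi
  simpa using this

/-- The sets of integers with the largest number of progressions. -/
theorem exists_image_extremal_of_T3_eq {S : Finset ℤ} (h : T3 S = (#S ^ 2 + 1) / 2) :
    ∃ (k m : ℕ) (a b : ℤ), a ≠ 0 ∧ (S = ((extremalE k m).image fun x => a * x + b) ∨
      S = (extremalF k m).image fun x => a * x + b) := by
  have hS := reflectsShortSide_of_T3_eq h
  obtain ⟨r, hr | hr⟩ := Nat.even_or_odd' #S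
  · rcases Nat.eq_zero_or_pos r with rfl | hpos
    · rw [mul_zero, card_eq_zero] at hr
      subst hr
      refine ⟨0, 0, 1, 0, one_ne_zero, Or.inr ?_⟩
      rw [eq_comm, image_eq_empty]
      ext x
      simp only [mem_extremalF, notMem_empty, iff_false]
      omega
    have hne : S.Nonempty := card_pos.1 (by omega)
    obtain ⟨y, hy, hy'⟩ := exists_card_lower_eq (S := S) (i := r - 1) (by omega)
    have hyc := card_lower_add_card_upper hy
    obtain ⟨M, hM, hMmax⟩ := S.exists_max_image id hne
    by_cases hM' : y + y - M ∈ S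
    swap
    · obtain ⟨k, m, a, ha, e⟩ := eq_image_extremalF hS hy (by omega) hM hMmax hM'
      exact ⟨k, m, a, y, ha, Or.inr e⟩
    -- Otherwise turn the set around and use the upper median `z`. If the minimum `μ` also had its
    -- mirror image `2z - μ` in `S`, then `2z ≤ M + μ ≤ 2y`, contradicting `y < z`.
    obtain ⟨z, hz, hz'⟩ := exists_card_lower_eq (S := S) (i := r) (by omega)
    have hzc := card_lower_add_card_upper hz
    obtain ⟨μ, hμ, hμmin⟩ := S.exists_min_image id hne
    have hyz : y < z := by
      by_contra hzy
      have : #{x ∈ S | x < z} ≤ #{x ∈ S | x < y} := card_le_card fun x hx => by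
        simp only [mem_filter] at hx ⊢
        exact ⟨hx.1, by omega⟩
      omega
    have hμ' : z + z - μ ∉ S := by
      intro h
      have h1 := hMmax _ h
      have h2 := hμmin _ hM'
      simp only [id] at h1 h2
      omega
    have hS' := hS.image_neg
    obtain ⟨k, m, a, ha, e⟩ := eq_image_extremalF (y := -z) (M := -μ) hS'
      (mem_image_of_mem _ hz) (by
        rw [filter_image, filter_image, card_image_of_injective _ neg_injective,
          card_image_of_injective _ neg_injective]
        simp only [neg_lt_neg_iff]
        omega)
      (mem_image_of_mem _ hμ) (by
        intro x hx
        obtain ⟨w, hw, rfl⟩ := mem_image.1 hx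
        have := hμmin w hw
        simp only [id] at this
        omega) (by
        intro h
        obtain ⟨w, hw, hw'⟩ := mem_image.1 h
        apply hμ'
        rwa [show z + z - μ = w by omega])
    refine ⟨k, m, -a, z, neg_ne_zero.2 ha, Or.inr ?_⟩
    have e' := congrArg (fun T : Finset ℤ => T.image fun x => -x) e
    simp only [image_image, Function.comp_def, neg_neg, image_id'] at e'
    rw [e']
    refine image_congr fun x _ => ?_
    ring
  · obtain ⟨y, hy, hy'⟩ := exists_card_lower_eq (S := S) (i := r) (by omega)
    have hyc := card_lower_add_card_upper hy
    obtain ⟨k, m, a, ha, e⟩ := eq_image_extremalE hS hy (by omega)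
    exact ⟨k, m, a, y, ha, Or.inl e⟩

end IntegerClassification

/-! ### From many progressions to a small difference set -/

section SmallDifference
open scoped Pointwise
variable {G : Type*} [AddCommGroup G] [DecidableEq G]

/-- The representations of `d` as a difference of two elements of `A`. -/
def diffReps (A : Finset G) (d : G) : Finset (G × G) := {p ∈ A ×ˢ A | p.1 - p.2 = d}

theorem mem_diffReps {A : Finset G} {d : G} {p : G × G} :
    p ∈ diffReps A d ↔ p.1 ∈ A ∧ p.2 ∈ A ∧ p.1 - p.2 = d := by
  simp [diffReps, and_assoc]

/-- Each common middle `b` gives `a - a' = (2b - a') - (2b - a)`, and distinct `b` give distinct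
representations. -/
theorem card_common_middle_le (h2 : Function.Injective fun x : G => x + x) (A : Finset G)
    (a a' : G) :
    #{b ∈ A | b + b - a ∈ A ∧ b + b - a' ∈ A} ≤ #(diffReps A (a - a')) := by
  refine card_le_card_of_injOn (fun b => (b + b - a', b + b - a)) ?_ ?_
  · intro b hb
    simp only [coe_filter, Set.mem_ofPred_eq] at hb
    exact mem_diffReps.2 ⟨hb.2.2, hb.2.1, by simp⟩
  · intro b _ c _ h
    simp only [Prod.mk.injEq, sub_left_inj] at h
    exact h2 h.1

/-- Write `e = (d₁ - c) + (c - d₂)` and represent both differences in `A`. The resulting quadruple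
determines `e`, and then `c`, so nothing is counted twice among the `#A ^ 4` quadruples. -/
theorem sum_card_mul_card_diffReps_le (A : Finset G) (C D : Finset G) (d : G → G × G)
    (k : ℕ) (hk : ∀ e ∈ D, (d e).1 - (d e).2 = e)
    (h : ∀ e ∈ D, k ≤ ∑ c ∈ C, #(diffReps A ((d e).1 - c)) * #(diffReps A (c - (d e).2))) :
    #D * k ≤ #A ^ 4 := by
  have hdisj : ∀ e, (C : Set G).PairwiseDisjoint fun c =>
      diffReps A ((d e).1 - c) ×ˢ diffReps A (c - (d e).2) := by
    intro e c _ c' _ hne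
    rw [Function.onFun, disjoint_left]
    rintro ⟨p, q⟩ hp hp'
    simp only [mem_product, mem_diffReps] at hp hp'
    apply hne
    have := hp.1.2.2.symm.trans hp'.1.2.2
    simpa using this
  calc #D * k ≤ ∑ e ∈ D, #{t ∈ (A ×ˢ A) ×ˢ (A ×ˢ A) |
        (t.1.1 - t.1.2) + (t.2.1 - t.2.2) = e} := by
        rw [← smul_eq_mul, ← sum_const]
        refine sum_le_sum fun e he => (h e he).trans ?_
        simp only [← card_product]
        rw [← card_biUnion (hdisj e)]
        refine card_le_card fun t ht => ?_
        simp only [mem_biUnion, mem_product, mem_diffReps, mem_filter] at ht ⊢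
        obtain ⟨c, -, h1, h2⟩ := ht
        refine ⟨⟨⟨h1.1, h1.2.1⟩, h2.1, h2.2.1⟩, ?_⟩
        rw [h1.2.2, h2.2.2, sub_add_sub_cancel, hk e he]
    _ = #{t ∈ (A ×ˢ A) ×ˢ (A ×ˢ A) | (t.1.1 - t.1.2) + (t.2.1 - t.2.2) ∈ D} := by
        rw [card_eq_sum_card_fiberwise (f := fun t : (G × G) × (G × G) =>
          (t.1.1 - t.1.2) + (t.2.1 - t.2.2)) (t := D)]
        · refine sum_congr rfl fun e he => ?_
          rw [filter_filter]
          refine congrArg card (filter_congr fun t _ => ?_)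
          exact ⟨fun h => ⟨h ▸ he, h⟩, fun h => h.2⟩
        · intro t ht
          exact (mem_filter.1 ht).2
    _ ≤ #((A ×ˢ A) ×ˢ (A ×ˢ A)) := card_filter_le _ _
    _ = #A ^ 4 := by simp only [card_product]; ring

/-- A set with many three-term progressions contains a large subset with small difference set. -/
theorem exists_subset_card_sub_le (h2 : Function.Injective fun x : G => x + x) {A : Finset G}
    (hne : A.Nonempty) (hA : #A ^ 2 ≤ 2 * T3 A) :
    ∃ B ⊆ A, #A ≤ 6 * #B ∧ #(B - B) ≤ 24576 * #A := by
  have hn : 0 < #A := hne.card_pos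
  set n := #A with hn_def
  let M : G → Finset G := fun b => {a ∈ A | b + b - a ∈ A}
  let cm : G → G → ℕ := fun a a' => #{b ∈ A | b + b - a ∈ A ∧ b + b - a' ∈ A}
  have hcm : ∀ a a', cm a a' ≤ #(diffReps A (a - a')) := card_common_middle_le h2 A
  have hsymm : ∀ a a', cm a a' = cm a' a := fun a a' => by
    simp only [cm, and_comm]
  let bad : G → Finset (G × G) := fun b => {p ∈ M b ×ˢ M b | 64 * cm p.1 p.2 < n}
  have hsum : n ^ 2 ≤ 2 * ∑ b ∈ A, #(M b) := by rwa [T3_eq_sum_middle] at hA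
  have hcs : (∑ b ∈ A, #(M b)) ^ 2 ≤ n * ∑ b ∈ A, #(M b) ^ 2 := sq_sum_le_card_mul_sum_sq
  have hbad : 64 * ∑ b ∈ A, #(bad b) ≤ n ^ 3 := by
    have h1 : ∑ b ∈ A, #(bad b) = ∑ p ∈ A ×ˢ A with 64 * cm p.1 p.2 < n, cm p.1 p.2 := by
      have h3 : ∀ b, bad b = {p ∈ {p ∈ A ×ˢ A | 64 * cm p.1 p.2 < n} |
          b + b - p.1 ∈ A ∧ b + b - p.2 ∈ A} := by
        intro b
        ext p
        simp only [bad, M, mem_filter, mem_product]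
        tauto
      simp only [h3]
      exact sum_card_bipartiteAbove_eq_sum_card_bipartiteBelow
        (fun (b : G) (p : G × G) => b + b - p.1 ∈ A ∧ b + b - p.2 ∈ A)
    rw [h1, mul_sum]
    calc ∑ p ∈ A ×ˢ A with 64 * cm p.1 p.2 < n, 64 * cm p.1 p.2
        ≤ ∑ p ∈ A ×ˢ A with 64 * cm p.1 p.2 < n, n :=
          sum_le_sum fun p hp => (mem_filter.1 hp).2.le
      _ ≤ n ^ 3 := by
          rw [sum_const, smul_eq_mul]
          calc _ ≤ #(A ×ˢ A) * n := Nat.mul_le_mul_right _ (card_filter_le _ _)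
            _ = n ^ 3 := by rw [card_product]; ring
  have h4 : n ^ 3 ≤ 4 * ∑ b ∈ A, #(M b) ^ 2 := by
    have : n * n ^ 3 ≤ n * (4 * ∑ b ∈ A, #(M b) ^ 2) := by
      calc n * n ^ 3 = (n ^ 2) ^ 2 := by ring
        _ ≤ (2 * ∑ b ∈ A, #(M b)) ^ 2 := Nat.pow_le_pow_left hsum 2
        _ = 4 * (∑ b ∈ A, #(M b)) ^ 2 := by ring
        _ ≤ 4 * (n * ∑ b ∈ A, #(M b) ^ 2) := Nat.mul_le_mul_left _ hcs
        _ = _ := by ring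
    exact Nat.le_of_mul_le_mul_left this hn
  -- Averaging `h4` and `hbad` together: this `b` has a large neighbourhood `M b` (`8m² ≥ n²`), at
  -- most an eighth of whose pairs are bad.
  obtain ⟨b, -, hb⟩ : ∃ b ∈ A, n ^ 2 + 64 * #(bad b) ≤ 8 * #(M b) ^ 2 := by
    apply exists_le_of_sum_le hne
    rw [sum_add_distrib, ← mul_sum, ← mul_sum, sum_const, smul_eq_mul, ← hn_def]
    have : n * n ^ 2 = n ^ 3 := by ring
    omega
  set m := #(M b) with hm_def
  have hnm : n ≤ 3 * m := by
    by_contra h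
    have : (3 * m) ^ 2 < n ^ 2 := Nat.pow_lt_pow_left (by omega) (by norm_num)
    nlinarith
  have hm : 0 < m := by omega
  let deg : G → ℕ := fun a => #{a' ∈ M b | 64 * cm a a' < n}
  -- Keep the points bad with at most a quarter of `M b`. Any two of them share at least half of `M
  -- b` as good intermediaries `c`.
  let B : Finset G := {a ∈ M b | 4 * deg a ≤ m}
  have hB : m ≤ 2 * #B := by
    have h1 : #(bad b) = ∑ a ∈ M b, deg a := by
      simp only [bad, deg]
      rw [card_filter, sum_product]
      exact sum_congr rfl fun a _ => (card_filter _ _).symm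
    have h3 : #{a ∈ M b | ¬ 4 * deg a ≤ m} * m ≤ 4 * #(bad b) := by
      rw [h1, mul_sum, ← smul_eq_mul, ← sum_const]
      calc _ ≤ ∑ a ∈ M b with ¬ 4 * deg a ≤ m, 4 * deg a :=
            sum_le_sum fun a ha => (not_le.1 (mem_filter.1 ha).2).le
        _ ≤ _ := sum_le_sum_of_subset (filter_subset _ _)
    have h5 : #B + #{a ∈ M b | ¬ 4 * deg a ≤ m} = m := card_filter_add_card_filter_not _
    have h6 : 2 * #{a ∈ M b | ¬ 4 * deg a ≤ m} ≤ m := by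
      refine Nat.le_of_mul_le_mul_right (c := m) ?_ hm
      nlinarith
    omega
  refine ⟨B, (filter_subset _ _).trans (filter_subset _ _), by omega, ?_⟩
  have hrep : ∀ e : G, ∃ p : G × G, e ∈ B - B → p.1 ∈ B ∧ p.2 ∈ B ∧ p.1 - p.2 = e := by
    intro e
    by_cases he : e ∈ B - B
    · obtain ⟨x, hx, y, hy, h⟩ := mem_sub.1 he
      exact ⟨(x, y), fun _ => ⟨hx, hy, h⟩⟩
    · exact ⟨(0, 0), fun h => absurd h he⟩
  choose d hd using hrep
  let S : G → ℕ := fun e => ∑ c ∈ M b, #(diffReps A ((d e).1 - c)) * #(diffReps A (c - (d e).2))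
  -- There are at least `m / 2 ≥ n / 6` good intermediaries, each giving at least `(n / 64)²` pairs
  -- of representations; `6 * 64² = 24576`.
  have hS : ∀ e ∈ B - B, n ^ 3 ≤ 24576 * S e := by
    intro e he
    obtain ⟨h1, h3, -⟩ := hd e he
    set a := (d e).1
    set a' := (d e).2
    have h1' := (mem_filter.1 h1).2
    have h3' := (mem_filter.1 h3).2
    let good : Finset G := {c ∈ M b | n ≤ 64 * cm a c ∧ n ≤ 64 * cm c a'}
    have hgood : m ≤ 2 * #good := by
      have hsub : M b ⊆ good ∪ ({c ∈ M b | 64 * cm a c < n} ∪ {c ∈ M b | 64 * cm a' c < n}) := by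
        intro c hc
        simp only [good, mem_union, mem_filter, hc, true_and, hsymm a' c]
        omega
      have h5 := (card_le_card hsub).trans ((card_union_le _ _).trans
        (Nat.add_le_add_left (card_union_le _ _) _))
      change m ≤ #good + (deg a + deg a') at h5
      omega
    have h6 : #good * n ^ 2 ≤ 4096 * S e := by
      calc #good * n ^ 2 = ∑ c ∈ good, n * n := by rw [sum_const, smul_eq_mul]; ring
        _ ≤ ∑ c ∈ good, (64 * #(diffReps A (a - c))) * (64 * #(diffReps A (c - a'))) := by
            refine sum_le_sum fun c hc => ?_
            have hc := (mem_filter.1 hc).2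
            exact Nat.mul_le_mul (hc.1.trans (Nat.mul_le_mul_left _ (hcm _ _)))
              (hc.2.trans (Nat.mul_le_mul_left _ (hcm _ _)))
        _ ≤ ∑ c ∈ M b, (64 * #(diffReps A (a - c))) * (64 * #(diffReps A (c - a'))) :=
            sum_le_sum_of_subset (filter_subset _ _)
        _ = 4096 * S e := by
            rw [mul_sum]
            exact sum_congr rfl fun c _ => by ring
    calc n ^ 3 = n * n ^ 2 := by ring
      _ ≤ (6 * #good) * n ^ 2 := Nat.mul_le_mul_right _ (by omega)
      _ = 6 * (#good * n ^ 2) := by ring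
      _ ≤ 6 * (4096 * S e) := Nat.mul_le_mul_left _ h6
      _ = 24576 * S e := by ring
  have hmain := sum_card_mul_card_diffReps_le A (M b) (B - B) d ((n ^ 3 + 24575) / 24576)
    (fun e he => (hd e he).2.2) (fun e he => by have := hS e he; change _ ≤ S e; omega)
  have h7 : n ^ 3 ≤ 24576 * ((n ^ 3 + 24575) / 24576) := by omega
  refine Nat.le_of_mul_le_mul_right (c := n ^ 3) ?_ (by positivity)
  calc #(B - B) * n ^ 3 ≤ #(B - B) * (24576 * ((n ^ 3 + 24575) / 24576)) :=
        Nat.mul_le_mul_left _ h7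
    _ = 24576 * (#(B - B) * ((n ^ 3 + 24575) / 24576)) := by ring
    _ ≤ 24576 * n ^ 4 := Nat.mul_le_mul_left _ hmain
    _ = 24576 * n * n ^ 3 := by ring

end SmallDifference

/-! ### Polynomial growth of iterated sumsets -/

section PolynomialGrowth
open scoped Pointwise
variable {G : Type*} [AddCommGroup G] [DecidableEq G]

theorem exists_sum_eq_of_mem_nsmul {X : Finset G} (k : ℕ) :
    ∀ y ∈ k • X, ∃ f : G → ℕ, (∀ x, f x ≤ k) ∧ y = ∑ x ∈ X, f x • x := by
  induction k with
  | zero =>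
    intro y hy
    rw [zero_nsmul, mem_zero] at hy
    exact ⟨fun _ => 0, fun _ => le_rfl, by simp [hy]⟩
  | succ k ih =>
    intro y hy
    rw [succ_nsmul] at hy
    obtain ⟨z, hz, x, hx, rfl⟩ := mem_add.1 hy
    obtain ⟨f, hf, rfl⟩ := ih z hz
    refine ⟨fun w => f w + if w = x then 1 else 0, fun w => ?_, ?_⟩
    · have := hf w
      dsimp only
      split_ifs <;> omega
    · simp [add_smul, sum_add_distrib, ite_smul, hx]

theorem card_nsmul_le_pow (X : Finset G) (k : ℕ) : #(k • X) ≤ (k + 1) ^ #X := by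
  have hsub : k • X ⊆ (Fintype.piFinset fun _ : X => range (k + 1)).image
      fun f => ∑ x : X, f x • (x : G) := by
    intro y hy
    obtain ⟨f, hf, rfl⟩ := exists_sum_eq_of_mem_nsmul k y hy
    refine mem_image.2 ⟨fun x => f x, ?_, ?_⟩
    · rw [Fintype.mem_piFinset]
      exact fun x => mem_range.2 (Nat.lt_succ_of_le (hf x))
    · exact sum_coe_sort X fun x => f x • x
  refine (card_le_card hsub).trans (card_image_le.trans ?_)
  simp [Fintype.card_piFinset]

/-- Each further summand `B` is absorbed by one more translate set `X`, so growth is governed by `k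
• X`, which is polynomial in `k` because its elements are described by bounded multiplicities. -/
theorem succ_nsmul_sub_subset {B X : Finset G} (h : B + B - B ⊆ X + (B - B)) (k : ℕ) :
    (k + 1) • B - B ⊆ k • X + (B - B) := by
  induction k with
  | zero => simp
  | succ k ih =>
    calc (k + 1 + 1) • B - B = ((k + 1) • B - B) + B := by
          rw [succ_nsmul, add_sub_right_comm]
      _ ⊆ (k • X + (B - B)) + B := add_subset_add_right ih
      _ = k • X + (B + B - B) := by rw [add_assoc, ← add_sub_right_comm]
      _ ⊆ k • X + (X + (B - B)) := add_subset_add_left h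
      _ = (k + 1) • X + (B - B) := by rw [← add_assoc, ← succ_nsmul]

/-- A set with small difference set has polynomial growth. -/
theorem card_succ_nsmul_le {B : Finset G} (hB : B.Nonempty) {K : ℕ}
    (hK : #(B - B) ≤ K * #B) (k : ℕ) :
    #((k + 1) • B) ≤ (k + 1) ^ K ^ 4 * (K * #B) := by
  have hpos : (0 : ℚ≥0) < #B := by exact_mod_cast hB.card_pos
  -- Covering `B + B - B` by translates of `B - B` needs `#(B + B - B + B)`, which is `3B - B`;
  -- Plünnecke–Ruzsa bounds it with exponent `3 + 1`.
  have hq : (#(B + B - B + B) : ℚ≥0) ≤ K ^ 4 * #B := by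
    have h1 := pluennecke_ruzsa_inequality_nsmul_sub_nsmul_sub hB B 3 1
    have h2 : B + B - B + B = 3 • B - 1 • B := by
      rw [one_nsmul, succ_nsmul, two_nsmul, ← add_sub_right_comm (B + B) B B]
    rw [h2]
    refine h1.trans ?_
    gcongr
    rw [div_le_iff₀ hpos]
    exact_mod_cast hK
  have hr : (#(B + B - B + B) : ℝ) ≤ ((K ^ 4 : ℕ) : ℝ) * #B := by exact_mod_cast hq
  obtain ⟨X, -, hX, hsub⟩ := ruzsa_covering_add hB hr
  have hX' : #X ≤ K ^ 4 := by exact_mod_cast hX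
  calc #((k + 1) • B) ≤ #((k + 1) • B - B) := card_le_card_sub_right hB
    _ ≤ #(k • X + (B - B)) := card_le_card (succ_nsmul_sub_subset hsub k)
    _ ≤ #(k • X) * #(B - B) := card_add_le
    _ ≤ (k + 1) ^ K ^ 4 * (K * #B) := by
        refine Nat.mul_le_mul ((card_nsmul_le_pow X k).trans ?_) hK
        exact Nat.pow_le_pow_right (Nat.succ_pos k) hX'

theorem sum_mem_nsmul {B : Finset G} {k : ℕ} {p : Fin k → G} (hp : ∀ i, p i ∈ B) :
    ∑ i, p i ∈ k • B := by
  rw [mem_nsmul]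
  exact ⟨fun i => ⟨p i, hp i⟩, by rw [List.sum_ofFn]⟩

end PolynomialGrowth

/-! ### A large Fourier coefficient at a nonzero frequency -/

section Fourier
variable {N : ℕ} [NeZero N]

/-- The exponential sum of a family of residues `s` over `P` at the frequency `r`. -/
noncomputable def expSum {ι : Type*} (P : Finset ι) (s : ι → ZMod N) (r : ZMod N) : ℂ :=
  ∑ p ∈ P, ZMod.stdAddChar (r * s p)

theorem normSq_expSum {ι : Type*} (P : Finset ι) (s : ι → ZMod N) (r : ZMod N) :
    ((‖expSum P s r‖ ^ 2 : ℝ) : ℂ) =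
      ∑ p ∈ P, ∑ q ∈ P, ZMod.stdAddChar (r * (s p - s q)) := by
  rw [← Complex.normSq_eq_norm_sq, ← Complex.mul_conj, expSum, map_sum, sum_mul_sum]
  refine sum_congr rfl fun p _ => sum_congr rfl fun q _ => ?_
  rw [← AddChar.map_neg_eq_conj, ← AddChar.map_add_eq_mul]
  congr 1
  ring

theorem sum_norm_sq_expSum {ι : Type*} (P : Finset ι) (s : ι → ZMod N) :
    ∑ r : ZMod N, ‖expSum P s r‖ ^ 2 = N * #{t ∈ P ×ˢ P | s t.1 = s t.2} := by
  have h : ((∑ r : ZMod N, ‖expSum P s r‖ ^ 2 : ℝ) : ℂ) =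
      ((N * #{t ∈ P ×ˢ P | s t.1 = s t.2} : ℝ) : ℂ) := by
    rw [Complex.ofReal_sum]
    simp only [normSq_expSum]
    simp only [← sum_product' P P]
    rw [sum_comm]
    have : ∀ t : ι × ι, ∑ r : ZMod N, (ZMod.stdAddChar (r * (s t.1 - s t.2)) : ℂ) =
        if s t.1 = s t.2 then (N : ℂ) else 0 := by
      intro t
      rw [AddChar.sum_mulShift _ (ZMod.isPrimitive_stdAddChar N)]
      simp [sub_eq_zero, ZMod.card]
    simp only [this]
    rw [← sum_filter, sum_const, nsmul_eq_mul]
    push_cast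
    ring
  exact_mod_cast h

/-- Cauchy–Schwarz over the fibres of `s`. -/
theorem card_sq_le_card_mul_card_coincidences {ι κ : Type*} [DecidableEq κ]
    (P : Finset ι) (s : ι → κ) {T : Finset κ} (hT : ∀ p ∈ P, s p ∈ T) :
    #P ^ 2 ≤ #T * #{t ∈ P ×ˢ P | s t.1 = s t.2} := by
  have h1 : #{t ∈ P ×ˢ P | s t.1 = s t.2} = ∑ c ∈ T, #{p ∈ P | s p = c} ^ 2 := by
    rw [card_eq_sum_card_fiberwise (f := fun t => s t.1) (t := T)]
    · refine sum_congr rfl fun c _ => ?_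
      rw [sq, ← card_product]
      congr 1
      ext t
      simp only [mem_filter, mem_product]
      constructor
      · rintro ⟨⟨⟨h1, h2⟩, h3⟩, rfl⟩
        exact ⟨⟨h1, rfl⟩, h2, h3.symm⟩
      · rintro ⟨⟨h1, rfl⟩, h2, h3⟩
        exact ⟨⟨⟨h1, h2⟩, h3.symm⟩, rfl⟩
    · intro t ht
      exact hT _ (mem_product.1 (mem_filter.1 ht).1).1
  rw [h1, card_eq_sum_card_fiberwise hT]
  exact sq_sum_le_card_mul_sum_sq

theorem norm_expSum_le {ι : Type*} (P : Finset ι) (s : ι → ZMod N) (r : ZMod N) :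
    ‖expSum P s r‖ ≤ #P := by
  refine (norm_sum_le _ _).trans ?_
  simp

theorem expSum_pow (B : Finset (ZMod N)) (k : ℕ) (r : ZMod N) :
    expSum B id r ^ k = expSum (Fintype.piFinset fun _ : Fin k => B) (fun p => ∑ i, p i) r := by
  unfold expSum
  rw [sum_pow']
  refine sum_congr rfl fun p _ => ?_
  simp only [id, mul_sum]
  exact (map_prod (ZMod.stdAddChar (N := N)).toMonoidHom
    (fun i => Multiplicative.ofAdd (r * p i)) univ).symm

-- The `2k`-th moment counts coincidences among `k`-fold sums from `B`, and these are numerous when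
-- all the sums fall into a small set `k • B`.
open scoped Pointwise in
theorem card_pow_le_sum_norm_expSum_pow (B : Finset (ZMod N)) (k : ℕ) :
    N * (#B : ℝ) ^ (2 * k) ≤ #(k • B) * ∑ r : ZMod N, ‖expSum B id r‖ ^ (2 * k) := by
  have h1 := card_sq_le_card_mul_card_coincidences (Fintype.piFinset fun _ : Fin k => B)
    (fun p => ∑ i, p i) (T := k • B) fun p hp =>
      sum_mem_nsmul fun i => Fintype.mem_piFinset.1 hp i
  have h2 := sum_norm_sq_expSum (Fintype.piFinset fun _ : Fin k => B)
    (fun p => ∑ i, p i)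
  simp only [← expSum_pow, norm_pow, ← pow_mul] at h2
  rw [Fintype.card_piFinset, prod_const, card_univ, Fintype.card_fin, ← pow_mul] at h1
  simp only [mul_comm k 2] at h1 h2
  rw [h2]
  have h3 : (#B : ℝ) ^ (2 * k) ≤ #(k • B) *
      #{t ∈ (Fintype.piFinset fun _ : Fin k => B) ×ˢ (Fintype.piFinset fun _ : Fin k => B) |
        ∑ i, t.1 i = ∑ i, t.2 i} := by exact_mod_cast h1
  calc _ ≤ (N : ℝ) * _ := mul_le_mul_of_nonneg_left h3 (Nat.cast_nonneg N)
    _ = _ := by ring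

theorem sum_norm_sq_expSum_id (B : Finset (ZMod N)) :
    ∑ r : ZMod N, ‖expSum B id r‖ ^ 2 = N * #B := by
  rw [sum_norm_sq_expSum]
  congr 2
  refine card_nbij' (fun t => t.1) (fun b => (b, b)) ?_ ?_ ?_ ?_ <;>
    simp +contextual [Set.MapsTo, Set.LeftInvOn, Set.RightInvOn]

open scoped Pointwise in
/-- A sparse set of residues with small difference set has an exponential sum, at a nonzero
frequency, that is almost as large as possible. -/
theorem exists_norm_expSum_ge (K : ℕ) {ρ : ℝ} (h0 : 0 < ρ) (h1 : ρ < 1) :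
    ∃ c : ℝ, 0 < c ∧ ∀ (N : ℕ) [NeZero N] (B : Finset (ZMod N)), B.Nonempty →
      #(B - B) ≤ K * #B → (#B : ℝ) ≤ c * N →
      ∃ r : ZMod N, r ≠ 0 ∧ ρ * #B ≤ ‖expSum B id r‖ := by
  have hlim : Filter.Tendsto (fun k : ℕ => (((k + 1 : ℕ) : ℝ) ^ (K ^ 4) * (ρ ^ 2) ^ (k + 1)))
      Filter.atTop (nhds 0) :=
    (tendsto_pow_const_mul_const_pow_of_abs_lt_one (K ^ 4) (r := ρ ^ 2)
      (by rw [abs_of_nonneg (by positivity)]; nlinarith)).comp (Filter.tendsto_add_atTop_nat 1)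
  -- Exponential decay of `ρ ^ (2k)` beats the polynomial growth of the sumset. If all nonzero
  -- frequencies were below `ρ * #B`, then for this `k` they would carry less than half of the
  -- moment's lower bound, while sparsity limits the zero frequency to the other half.
  obtain ⟨k, hk⟩ := (hlim.eventually (gt_mem_nhds
    (show 0 < ρ ^ 2 / (2 * (K + 1)) by positivity))).exists
  set D : ℝ := ((k + 1 : ℕ) : ℝ) ^ (K ^ 4) with hD
  have hDpos : 0 < D := by positivity
  have hKpos : (0 : ℝ) < K + 1 := by positivity
  have hk' : D * (K + 1) * (ρ ^ 2) ^ k < 1 / 2 := by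
    rw [pow_succ, lt_div_iff₀ (by positivity)] at hk
    have hρ : 0 < ρ ^ 2 := by positivity
    by_contra hcon
    have : 1 / 2 * ρ ^ 2 ≤ D * (K + 1) * (ρ ^ 2) ^ k * ρ ^ 2 :=
      mul_le_mul_of_nonneg_right (not_lt.1 hcon) hρ.le
    nlinarith
  refine ⟨1 / (2 * (D * (K + 1))), by positivity, fun N _ B hB hBK hBN => ?_⟩
  by_contra! hcon
  have hN : (0 : ℝ) < N := by exact_mod_cast NeZero.pos N
  have hb : (0 : ℝ) < #B := by exact_mod_cast hB.card_pos
  have hgrow : (#((k + 1) • B) : ℝ) ≤ D * (K + 1) * #B := by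
    have : (#((k + 1) • B) : ℝ) ≤ D * (K * #B) := by
      rw [hD]
      exact_mod_cast card_succ_nsmul_le hB hBK k
    nlinarith [mul_pos hDpos hb]
  have hsum : ∑ r : ZMod N, ‖expSum B id r‖ ^ (2 * (k + 1)) ≤
      (#B : ℝ) ^ (2 * (k + 1)) + (ρ * #B) ^ (2 * k) * (N * #B) := by
    rw [← sum_norm_sq_expSum_id, ← add_sum_erase _ _ (mem_univ (0 : ZMod N)), mul_sum]
    refine add_le_add (pow_le_pow_left₀ (norm_nonneg _) (norm_expSum_le _ _ _) _) ?_
    calc _ ≤ ∑ r ∈ univ.erase (0 : ZMod N), (ρ * #B) ^ (2 * k) * ‖expSum B id r‖ ^ 2 := by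
          refine sum_le_sum fun r hr => ?_
          rw [mul_add, pow_add]
          exact mul_le_mul_of_nonneg_right (pow_le_pow_left₀ (norm_nonneg _)
            (hcon r (ne_of_mem_erase hr)).le _) (by positivity)
      _ ≤ _ := sum_le_sum_of_subset_of_nonneg (erase_subset _ _) fun r _ _ => by positivity
  have hmain := (card_pow_le_sum_norm_expSum_pow B (k + 1)).trans
    (mul_le_mul hgrow hsum (by positivity) (by positivity))
  have e1 : (N : ℝ) * (#B : ℝ) ^ (2 * (k + 1)) = (#B : ℝ) ^ (2 * k + 2) * N := by ring
  have e2 : D * (K + 1) * #B * ((#B : ℝ) ^ (2 * (k + 1)) + (ρ * #B) ^ (2 * k) * (N * #B)) =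
      (#B : ℝ) ^ (2 * k + 2) * (D * (K + 1) * #B + D * (K + 1) * (ρ ^ 2) ^ k * N) := by
    rw [mul_pow, pow_mul ρ]
    ring
  rw [e1, e2] at hmain
  have h2 := le_of_mul_le_mul_left hmain (by positivity)
  have h3 : D * (K + 1) * #B ≤ N / 2 := by
    rw [one_div, inv_mul_eq_div, le_div_iff₀ (by positivity)] at hBN
    linarith
  nlinarith

end Fourier

/-! ### Arcs on the cycle and simultaneous approximation -/

section CircleNorm
variable {N : ℕ}

/-- The distance from a residue to zero on the cycle `ZMod N`. -/
def circNorm (x : ZMod N) : ℕ := x.valMinAbs.natAbs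

theorem circNorm_add_le (x y : ZMod N) : circNorm (x + y) ≤ circNorm x + circNorm y :=
  (ZMod.natAbs_valMinAbs_add_le x y).trans (Int.natAbs_add_le _ _)

theorem circNorm_neg (x : ZMod N) : circNorm (-x) = circNorm x := ZMod.natAbs_valMinAbs_neg x

theorem circNorm_zero : circNorm (0 : ZMod N) = 0 := by simp [circNorm]

theorem circNorm_natCast_mul_le (q : ℕ) (x : ZMod N) :
    circNorm ((q : ZMod N) * x) ≤ q * circNorm x := by
  induction q with
  | zero => simp [circNorm_zero]
  | succ q ih =>
    rw [Nat.cast_succ, add_one_mul, add_one_mul]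
    exact (circNorm_add_le _ _).trans (Nat.add_le_add_right ih _)

theorem circNorm_intCast_le [NeZero N] (i : ℤ) : circNorm (i : ZMod N) ≤ i.natAbs :=
  ZMod.natAbs_min_of_le_div_two N _ _ (by simp) (ZMod.natAbs_valMinAbs_le _)

theorem one_sub_re_stdAddChar_ge [NeZero N] (x : ZMod N) :
    8 * ((circNorm x : ℝ) / N) ^ 2 ≤ 1 - (ZMod.stdAddChar x : ℂ).re := by
  have hN : (0 : ℝ) < N := by exact_mod_cast NeZero.pos N
  have h1 : (ZMod.stdAddChar x : ℂ).re = Real.cos (2 * Real.pi * (x.valMinAbs / N)) := by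
    conv_lhs => rw [← ZMod.coe_valMinAbs x]
    rw [ZMod.stdAddChar_coe]
    have : (2 * Real.pi * Complex.I * (x.valMinAbs : ℂ) / (N : ℂ)) =
        ((2 * Real.pi * (x.valMinAbs / N) : ℝ) : ℂ) * Complex.I := by
      push_cast
      ring
    rw [this, Complex.exp_ofReal_mul_I_re]
  have habs : (circNorm x : ℝ) = |(x.valMinAbs : ℝ)| := by
    rw [circNorm, Nat.cast_natAbs, Int.cast_abs]
  have hle : |(x.valMinAbs : ℝ)| ≤ N / 2 := by
    rw [← habs]
    have h2 : circNorm x * 2 ≤ N := by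
      have := ZMod.natAbs_valMinAbs_le x
      unfold circNorm
      omega
    have h3 : (circNorm x : ℝ) * 2 ≤ N := by exact_mod_cast h2
    linarith
  have h2 := Real.cos_le_one_sub_mul_cos_sq (x := 2 * Real.pi * (x.valMinAbs / N)) (by
    rw [abs_mul, abs_div, abs_of_pos Real.two_pi_pos, abs_of_pos hN]
    have : |(x.valMinAbs : ℝ)| / N ≤ 1 / 2 := by
      rw [div_le_iff₀ hN]
      linarith
    nlinarith [Real.pi_pos])
  have h3 : 2 / Real.pi ^ 2 * (2 * Real.pi * (x.valMinAbs / N)) ^ 2 =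
      8 * ((circNorm x : ℝ) / N) ^ 2 := by
    rw [habs, div_pow, sq_abs, mul_pow, mul_pow, div_pow]
    field_simp
    ring
  rw [h1]
  linarith

/-- A set with a large exponential sum is concentrated on a short arc. -/
theorem exists_arc_of_norm_expSum_ge [NeZero N] {B : Finset (ZMod N)} (hB : B.Nonempty)
    {τ ρ : ℝ} (hτ : 0 < τ) (hρ0 : 0 ≤ ρ) (hρ : 1 - 4 * τ ^ 2 ≤ ρ ^ 2) {r : ZMod N}
    (h : ρ * #B ≤ ‖expSum B id r‖) :
    ∃ x : ZMod N, #B ≤ 2 * #{b ∈ B | (circNorm (r * b - x) : ℝ) ≤ τ * N} := by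
  have hN : (0 : ℝ) < N := by exact_mod_cast NeZero.pos N
  have hb : (0 : ℝ) < #B := by exact_mod_cast hB.card_pos
  have h1 := congrArg Complex.re (normSq_expSum B id r)
  simp only [Complex.re_sum, Complex.ofReal_re, id] at h1
  have h2 : (ρ * #B) ^ 2 ≤ ‖expSum B id r‖ ^ 2 := pow_le_pow_left₀ (by positivity) h 2
  rw [h1, sum_comm] at h2
  obtain ⟨b0, -, h3⟩ : ∃ b0 ∈ B, ρ ^ 2 * #B ≤
      ∑ b ∈ B, (ZMod.stdAddChar (r * (b - b0)) : ℂ).re := by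
    apply exists_le_of_sum_le hB
    rw [sum_const, nsmul_eq_mul]
    calc _ = (ρ * #B) ^ 2 := by ring
      _ ≤ _ := h2
  refine ⟨r * b0, ?_⟩
  by_contra! hcon
  have h4 := card_filter_add_card_filter_not (s := B)
    (fun b => (circNorm (r * b - r * b0) : ℝ) ≤ τ * N)
  -- More than half of `B` would lose at least `8τ²` each, a total loss above `4τ² * #B`, whereas
  -- the average over base points allows at most `(1 - ρ²) * #B`.
  have h5 : #B < 2 * #{b ∈ B | ¬ (circNorm (r * b - r * b0) : ℝ) ≤ τ * N} := by omega
  have h5' : (#B : ℝ) < 2 * #{b ∈ B | ¬ (circNorm (r * b - r * b0) : ℝ) ≤ τ * N} := by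
    exact_mod_cast h5
  have h6 : (#{b ∈ B | ¬ (circNorm (r * b - r * b0) : ℝ) ≤ τ * N} : ℝ) * (8 * τ ^ 2) ≤
      ∑ b ∈ B, (1 - (ZMod.stdAddChar (r * (b - b0)) : ℂ).re) := by
    rw [← nsmul_eq_mul, ← sum_const]
    refine (sum_le_sum fun b hb => ?_).trans (sum_le_sum_of_subset_of_nonneg
      (filter_subset _ _) fun b _ _ => ?_)
    · have h7 := not_le.1 (mem_filter.1 hb).2
      refine le_trans ?_ (one_sub_re_stdAddChar_ge _)
      rw [mul_sub]
      have : τ ≤ (circNorm (r * b - r * b0) : ℝ) / N := by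
        rw [le_div_iff₀ hN]
        exact h7.le
      gcongr
    · exact le_trans (by positivity) (one_sub_re_stdAddChar_ge _)
  rw [sum_sub_distrib, sum_const, nsmul_eq_mul, mul_one] at h6
  have hτ2 : 0 < τ ^ 2 := by positivity
  nlinarith

/-- Dirichlet's simultaneous approximation theorem on the cycle. -/
theorem exists_mul_circNorm_le [NeZero N] (X : Finset (ZMod N)) {M : ℕ} (hM : 0 < M) :
    ∃ q : ℕ, 0 < q ∧ q ≤ M ^ #X ∧ ∀ x ∈ X, M * circNorm ((q : ZMod N) * x) ≤ N := by
  have hN : 0 < N := NeZero.pos N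
  let f : ℕ → X → Fin M := fun q x => ⟨M * ((q : ZMod N) * x).val / N, by
    rw [Nat.div_lt_iff_lt_mul hN]
    exact Nat.mul_lt_mul_of_pos_left (ZMod.val_lt _) hM⟩
  obtain ⟨q, hq, q', hq', hne, he⟩ := exists_ne_map_eq_of_card_lt_of_maps_to
    (s := range (M ^ #X + 1)) (t := (univ : Finset (X → Fin M))) (f := f) (by simp)
    (fun _ _ => mem_univ _)
  wlog hlt : q < q' generalizing q q'
  · exact this q' hq' q hq hne.symm he.symm (by omega)
  refine ⟨q' - q, by omega, ?_, fun x hx => ?_⟩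
  · have := mem_range.1 hq'
    omega
  have h1 := congrArg Fin.val (congrFun he ⟨x, hx⟩)
  simp only [f] at h1
  set u := ((q : ZMod N) * x).val with hu
  set v := ((q' : ZMod N) * x).val with hv
  have h2 : ((q' - q : ℕ) : ZMod N) * x = (((v : ℤ) - u : ℤ) : ZMod N) := by
    push_cast [hu, hv, hlt.le]
    rw [ZMod.natCast_zmod_val, ZMod.natCast_zmod_val, sub_mul]
  rw [h2]
  refine (Nat.mul_le_mul_left _ (circNorm_intCast_le _)).trans ?_
  have h3 := Nat.div_add_mod (M * u) N
  have h4 := Nat.div_add_mod (M * v) N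
  have h5 := Nat.mod_lt (M * u) hN
  have h6 := Nat.mod_lt (M * v) hN
  rw [h1] at h3
  have h7 : ((M * ((v : ℤ) - u).natAbs : ℕ) : ℤ) = |((M * v : ℕ) : ℤ) - ((M * u : ℕ) : ℤ)| := by
    push_cast
    rw [← mul_sub, abs_mul, Nat.abs_cast]
  have h8 : |((M * v : ℕ) : ℤ) - ((M * u : ℕ) : ℤ)| ≤ N := by
    rw [abs_le]
    constructor <;> omega
  omega

end CircleNorm

/-! ### Mixed progressions and the growth step -/

section Growth

theorem card_le_mul_of_fiber_le {α β : Type*} [DecidableEq β] {s : Finset α} {A : Finset β}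
    (f : α → β) {D : ℕ} (hf : ∀ t ∈ s, f t ∈ A) (h : ∀ a ∈ A, #{t ∈ s | f t = a} ≤ D) :
    #s ≤ D * #A := card_le_mul_card_image_of_maps_to hf D h

variable {G : Type*} [AddCommGroup G] [DecidableEq G]

/-- If the progressions of `A` that meet both `U` and its complement are spread out, they are
few. -/
theorem T3_le_add_of_fibers_le (h2 : Function.Injective fun x : G => x + x) {A U : Finset G}
    {D : ℕ} (h1 : ∀ x, #{c ∈ A \ U | x - c ∈ U} ≤ D)
    (h3 : ∀ x, #{c ∈ A \ U | c + c - x ∈ U} ≤ D)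
    (h4 : ∀ x, #{c ∈ A \ U | ∃ u ∈ U, u + u - c = x} ≤ D) :
    T3 A ≤ T3 U + T3 (A \ U) + 6 * (D * #A) := by
  simp only [T3_eq_card_apTriples]
  set S := apTriples A
  -- A mixed progression has one term in `U` and another outside it. For each of the six position
  -- pairs, the remaining term has `#A` choices and the fibre over it has size at most `D`.
  have e : S ⊆ apTriples U ∪ apTriples (A \ U) ∪
      ({t ∈ S | t.1 ∈ U ∧ t.2.2 ∈ A \ U} ∪ {t ∈ S | t.2.2 ∈ U ∧ t.1 ∈ A \ U} ∪
        ({t ∈ S | t.1 ∈ U ∧ t.2.1 ∈ A \ U} ∪ {t ∈ S | t.2.2 ∈ U ∧ t.2.1 ∈ A \ U}) ∪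
        ({t ∈ S | t.2.1 ∈ U ∧ t.1 ∈ A \ U} ∪ {t ∈ S | t.2.1 ∈ U ∧ t.2.2 ∈ A \ U})) := by
    rintro ⟨x, y, z⟩ ht
    simp only [mem_union, mem_filter, ht, true_and, mem_apTriples, mem_sdiff]
    obtain ⟨hx, hy, hz, h⟩ := mem_apTriples.1 ht
    simp only [hx, hy, hz, h, true_and, and_true]
    tauto
  have c1 : #{t ∈ S | t.1 ∈ U ∧ t.2.2 ∈ A \ U} ≤ D * #A := by
    refine card_le_mul_of_fiber_le (fun t => t.2.1) ?_ fun y _ => (card_le_card_of_injOn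
      (fun t => t.2.2) ?_ ?_).trans (h1 (y + y))
    · rintro ⟨x, y, z⟩ ht
      exact (mem_apTriples.1 (mem_filter.1 ht).1).2.1
    · rintro ⟨x, y, z⟩ ht
      simp only [coe_filter, Set.mem_ofPred_eq, S, mem_filter, mem_apTriples] at ht ⊢
      obtain ⟨⟨⟨-, -, -, h⟩, hx, hz⟩, rfl⟩ := ht
      exact ⟨hz, by rwa [← h, add_sub_cancel_right]⟩
    · rintro ⟨x, y, z⟩ ht ⟨x', y', z'⟩ ht' h
      simp only [coe_filter, Set.mem_ofPred_eq, S, mem_filter, mem_apTriples] at ht ht' h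
      obtain ⟨⟨⟨-, -, -, h5⟩, -⟩, rfl⟩ := ht
      obtain ⟨⟨⟨-, -, -, h6⟩, -⟩, rfl⟩ := ht'
      subst h
      rw [← h6] at h5
      simpa using h5
  have c2 : #{t ∈ S | t.2.2 ∈ U ∧ t.1 ∈ A \ U} ≤ D * #A := by
    refine card_le_mul_of_fiber_le (fun t => t.2.1) ?_ fun y _ => (card_le_card_of_injOn
      (fun t => t.1) ?_ ?_).trans (h1 (y + y))
    · rintro ⟨x, y, z⟩ ht
      exact (mem_apTriples.1 (mem_filter.1 ht).1).2.1
    · rintro ⟨x, y, z⟩ ht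
      simp only [coe_filter, Set.mem_ofPred_eq, S, mem_filter, mem_apTriples] at ht ⊢
      obtain ⟨⟨⟨-, -, -, h⟩, hz, hx⟩, rfl⟩ := ht
      exact ⟨hx, by rwa [← h, add_sub_cancel_left]⟩
    · rintro ⟨x, y, z⟩ ht ⟨x', y', z'⟩ ht' h
      simp only [coe_filter, Set.mem_ofPred_eq, S, mem_filter, mem_apTriples] at ht ht' h
      obtain ⟨⟨⟨-, -, -, h5⟩, -⟩, rfl⟩ := ht
      obtain ⟨⟨⟨-, -, -, h6⟩, -⟩, rfl⟩ := ht'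
      subst h
      rw [← h6] at h5
      simpa using h5
  have c3 : #{t ∈ S | t.1 ∈ U ∧ t.2.1 ∈ A \ U} ≤ D * #A := by
    refine card_le_mul_of_fiber_le (fun t => t.2.2) ?_ fun z _ => (card_le_card_of_injOn
      (fun t => t.2.1) ?_ ?_).trans (h3 z)
    · rintro ⟨x, y, z⟩ ht
      exact (mem_apTriples.1 (mem_filter.1 ht).1).2.2.1
    · rintro ⟨x, y, z⟩ ht
      simp only [coe_filter, Set.mem_ofPred_eq, S, mem_filter, mem_apTriples] at ht ⊢
      obtain ⟨⟨⟨-, -, -, h⟩, hx, hy⟩, rfl⟩ := ht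
      exact ⟨hy, by rwa [← h, add_sub_cancel_right]⟩
    · rintro ⟨x, y, z⟩ ht ⟨x', y', z'⟩ ht' h
      simp only [coe_filter, Set.mem_ofPred_eq, S, mem_filter, mem_apTriples] at ht ht' h
      obtain ⟨⟨⟨-, -, -, h5⟩, -⟩, rfl⟩ := ht
      obtain ⟨⟨⟨-, -, -, h6⟩, -⟩, rfl⟩ := ht'
      subst h
      rw [← h6] at h5
      simpa using h5
  have c4 : #{t ∈ S | t.2.2 ∈ U ∧ t.2.1 ∈ A \ U} ≤ D * #A := by
    refine card_le_mul_of_fiber_le (fun t => t.1) ?_ fun x _ => (card_le_card_of_injOn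
      (fun t => t.2.1) ?_ ?_).trans (h3 x)
    · rintro ⟨x, y, z⟩ ht
      exact (mem_apTriples.1 (mem_filter.1 ht).1).1
    · rintro ⟨x, y, z⟩ ht
      simp only [coe_filter, Set.mem_ofPred_eq, S, mem_filter, mem_apTriples] at ht ⊢
      obtain ⟨⟨⟨-, -, -, h⟩, hz, hy⟩, rfl⟩ := ht
      exact ⟨hy, by rwa [← h, add_sub_cancel_left]⟩
    · rintro ⟨x, y, z⟩ ht ⟨x', y', z'⟩ ht' h
      simp only [coe_filter, Set.mem_ofPred_eq, S, mem_filter, mem_apTriples] at ht ht' h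
      obtain ⟨⟨⟨-, -, -, h5⟩, -⟩, rfl⟩ := ht
      obtain ⟨⟨⟨-, -, -, h6⟩, -⟩, rfl⟩ := ht'
      subst h
      rw [← h6] at h5
      simpa using h5
  have c5 : #{t ∈ S | t.2.1 ∈ U ∧ t.1 ∈ A \ U} ≤ D * #A := by
    refine card_le_mul_of_fiber_le (fun t => t.2.2) ?_ fun z _ => (card_le_card_of_injOn
      (fun t => t.1) ?_ ?_).trans (h4 z)
    · rintro ⟨x, y, z⟩ ht
      exact (mem_apTriples.1 (mem_filter.1 ht).1).2.2.1
    · rintro ⟨x, y, z⟩ ht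
      simp only [coe_filter, Set.mem_ofPred_eq, S, mem_filter, mem_apTriples] at ht ⊢
      obtain ⟨⟨⟨-, -, -, h⟩, hy, hx⟩, rfl⟩ := ht
      exact ⟨hx, y, hy, by rw [← h, add_sub_cancel_left]⟩
    · rintro ⟨x, y, z⟩ ht ⟨x', y', z'⟩ ht' h
      simp only [coe_filter, Set.mem_ofPred_eq, S, mem_filter, mem_apTriples] at ht ht' h
      obtain ⟨⟨⟨-, -, -, h5⟩, -⟩, rfl⟩ := ht
      obtain ⟨⟨⟨-, -, -, h6⟩, -⟩, rfl⟩ := ht'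
      subst h
      rw [h6] at h5
      simpa using (h2 h5).symm
  have c6 : #{t ∈ S | t.2.1 ∈ U ∧ t.2.2 ∈ A \ U} ≤ D * #A := by
    refine card_le_mul_of_fiber_le (fun t => t.1) ?_ fun x _ => (card_le_card_of_injOn
      (fun t => t.2.2) ?_ ?_).trans (h4 x)
    · rintro ⟨x, y, z⟩ ht
      exact (mem_apTriples.1 (mem_filter.1 ht).1).1
    · rintro ⟨x, y, z⟩ ht
      simp only [coe_filter, Set.mem_ofPred_eq, S, mem_filter, mem_apTriples] at ht ⊢
      obtain ⟨⟨⟨-, -, -, h⟩, hy, hz⟩, rfl⟩ := ht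
      exact ⟨hz, y, hy, by rw [← h, add_sub_cancel_right]⟩
    · rintro ⟨x, y, z⟩ ht ⟨x', y', z'⟩ ht' h
      simp only [coe_filter, Set.mem_ofPred_eq, S, mem_filter, mem_apTriples] at ht ht' h
      obtain ⟨⟨⟨-, -, -, h5⟩, -⟩, rfl⟩ := ht
      obtain ⟨⟨⟨-, -, -, h6⟩, -⟩, rfl⟩ := ht'
      subst h
      rw [h6] at h5
      simpa using (h2 h5).symm
  refine (card_le_card e).trans ((card_union_le _ _).trans (Nat.add_le_add (card_union_le _ _)
    ((card_union_le _ _).trans (Nat.add_le_add ((card_union_le _ _).trans (Nat.add_le_add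
      (card_union_le _ _) (card_union_le _ _))) (card_union_le _ _)))) |>.trans ?_)
  omega

/-- If no proper subset of `A` beats the bound, a substantial part of `A` outside `U` lies in an
affine copy of `U`. -/
theorem exists_subset_affine_copy (h2 : Function.Injective fun x : G => x + x) {A U : Finset G}
    (hU : U ⊆ A) (hA : #A ^ 2 ≤ 2 * T3 A) (h3 : 3 ≤ #A) (hU0 : #A ≤ 12 * #U)
    (hC : #A < 100 * #(A \ U)) (hsub : ∀ B ⊂ A, T3 B ≤ (#B ^ 2 + 1) / 2) :
    ∃ P ⊆ A \ U, #A ≤ 20000 * #P ∧ ∃ x, (∀ c ∈ P, x - c ∈ U) ∨ (∀ c ∈ P, c + c - x ∈ U) ∨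
      (∀ c ∈ P, ∃ u ∈ U, u + u - c = x) := by
  by_contra! hcon
  have hcard := card_sdiff_add_card_eq_card hU
  set n := #A
  have hfib : ∀ P ⊆ A \ U, (∃ x, (∀ c ∈ P, x - c ∈ U) ∨ (∀ c ∈ P, c + c - x ∈ U) ∨
      (∀ c ∈ P, ∃ u ∈ U, u + u - c = x)) → #P ≤ n / 20000 := by
    intro P hP hx
    by_contra hlt
    obtain ⟨x, hx⟩ := hx
    obtain ⟨⟨c1, hc1, h1⟩, ⟨c2, hc2, h2⟩, ⟨c3, hc3, h3⟩⟩ := hcon P hP (by omega) x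
    rcases hx with hx | hx | hx
    · exact h1 (hx _ hc1)
    · exact h2 (hx _ hc2)
    · obtain ⟨u, hu, h⟩ := hx _ hc3
      exact h3 u hu h
  have hT := T3_le_add_of_fibers_le h2 (D := n / 20000)
    (fun x => hfib _ (filter_subset _ _) ⟨x, Or.inl fun c hc => (mem_filter.1 hc).2⟩)
    (fun x => hfib _ (filter_subset _ _) ⟨x, Or.inr (Or.inl fun c hc => (mem_filter.1 hc).2)⟩)
    (fun x => hfib _ (filter_subset _ _) ⟨x, Or.inr (Or.inr fun c hc => (mem_filter.1 hc).2)⟩)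
  have hU' := hsub U (ssubset_of_subset_of_ne hU (by
    rintro rfl
    simp at hC))
  have hC' := hsub (A \ U) (ssubset_of_subset_of_ne sdiff_subset (fun h => by
    have := congrArg card h
    omega))
  set u := #U
  set v := #(A \ U)
  have hD : 20000 * (n / 20000) ≤ n := Nat.mul_div_le _ _
  set D := n / 20000
  have hu : 1 ≤ u := by omega
  have hv : 1 ≤ v := by omega
  have h5 : 2 * T3 U ≤ u ^ 2 + 1 := by omega
  have h6 : 2 * T3 (A \ U) ≤ v ^ 2 + 1 := by omega
  have h7 : 20000 * (D * n) ≤ n * n := by nlinarith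
  have h8 : n ^ 2 = u ^ 2 + v ^ 2 + 2 * (u * v) := by rw [← hcard]; ring
  -- Subadditivity leaves `2uv ≤ 2 + 12Dn`. Since `uv ≥ 2` absorbs the rounding term, this yields
  -- `uv ≤ 12n² / 20000`, incompatible with `n² < 1200uv`.
  have h9 : 2 ≤ u * v := by
    rcases Nat.lt_or_ge 1 u with h | h
    · nlinarith
    · have : 2 ≤ v := by omega
      nlinarith
  have h10 : n * n < 1200 * (u * v) := by
    calc n * n ≤ (12 * u) * n := Nat.mul_le_mul_right _ hU0
      _ < (12 * u) * (100 * v) := Nat.mul_lt_mul_of_pos_left hC (by omega)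
      _ = _ := by ring
  change T3 A ≤ T3 U + T3 (A \ U) + 6 * (D * n) at hT
  omega

end Growth

/-! ### Concentrating 99% of the set on one short arc -/

section Concentration
variable {N : ℕ}

/-- After dilation by `r`, the set `U` is covered by `m` arcs of radius `ℓ`. -/
def CoveredByArcs (r : ZMod N) (m : ℕ) (ℓ : ℝ) (U : Finset (ZMod N)) : Prop :=
  ∃ X : Finset (ZMod N), #X ≤ m ∧ ∀ u ∈ U, ∃ x ∈ X, (circNorm (r * u - x) : ℝ) ≤ ℓ

/-- Passing to the frequency `2r` is forced by `2c = x + u`, which locates only the double of `c`.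
The worst loss in radius is the factor 4, from `c = 2u - x`, where `2rc = 4ru - 2rx`. -/
theorem CoveredByArcs.union_affine_copy {r : ZMod N} {m : ℕ} {ℓ : ℝ} {U P : Finset (ZMod N)}
    (h : CoveredByArcs r m ℓ U) {x : ZMod N} (hP : (∀ c ∈ P, x - c ∈ U) ∨
      (∀ c ∈ P, c + c - x ∈ U) ∨ (∀ c ∈ P, ∃ u ∈ U, u + u - c = x)) :
    CoveredByArcs (2 * r) (2 * m) (4 * ℓ) (U ∪ P) := by
  obtain ⟨X, hX, hc⟩ := h
  have key : ∀ f : ZMod N → ZMod N,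
      (∀ c ∈ P, ∃ u ∈ U, ∃ k : ℕ, k ≤ 4 ∧ ∀ y ∈ X,
        circNorm (2 * r * c - f y) ≤ k * circNorm (r * u - y)) →
      CoveredByArcs (2 * r) (2 * m) (4 * ℓ) (U ∪ P) := by
    intro f hf
    refine ⟨X.image (fun y => 2 * y) ∪ X.image f, ?_, fun c hcUP => ?_⟩
    · have h1 := card_union_le (X.image fun y => 2 * y) (X.image f)
      have h2 := card_image_le (s := X) (f := fun y => 2 * y)
      have h3 := card_image_le (s := X) (f := f)
      omega
    have hscale : ∀ k a b : ℕ, k ≤ 4 → a ≤ k * b → (b : ℝ) ≤ ℓ → (a : ℝ) ≤ 4 * ℓ := by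
      intro k a b hk hab hb
      have : a ≤ 4 * b := hab.trans (Nat.mul_le_mul_right _ hk)
      have : (a : ℝ) ≤ 4 * b := by exact_mod_cast this
      linarith
    rcases mem_union.1 hcUP with hcU | hcP
    · obtain ⟨y, hy, hle⟩ := hc c hcU
      refine ⟨2 * y, mem_union_left _ (mem_image_of_mem _ hy), ?_⟩
      refine hscale 2 _ _ (by norm_num) ?_ hle
      have := circNorm_natCast_mul_le 2 (r * c - y)
      rwa [show ((2 : ℕ) : ZMod N) * (r * c - y) = 2 * r * c - 2 * y by push_cast; ring] at this
    · obtain ⟨u, hu, k, hk, hk'⟩ := hf c hcP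
      obtain ⟨y, hy, hle⟩ := hc u hu
      exact ⟨f y, mem_union_right _ (mem_image_of_mem _ hy), hscale k _ _ hk (hk' y hy) hle⟩
  rcases hP with hP | hP | hP
  · refine key (fun y => 2 * r * x - 2 * y) fun c hc => ⟨_, hP c hc, 2, by norm_num, fun y _ => ?_⟩
    have := circNorm_natCast_mul_le 2 (r * (x - c) - y)
    rwa [← circNorm_neg, show -(((2 : ℕ) : ZMod N) * (r * (x - c) - y)) =
      2 * r * c - (2 * r * x - 2 * y) by push_cast; ring] at this
  · refine key (fun y => r * x + y) fun c hc => ⟨_, hP c hc, 1, by norm_num, fun y _ => ?_⟩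
    rw [one_mul, show r * (c + c - x) - y = 2 * r * c - (r * x + y) by ring]
  · refine key (fun y => 4 * y - 2 * r * x) fun c hc => ?_
    obtain ⟨u, hu, rfl⟩ := hP c hc
    refine ⟨u, hu, 4, le_rfl, fun y _ => ?_⟩
    have := circNorm_natCast_mul_le 4 (r * u - y)
    rwa [show ((4 : ℕ) : ZMod N) * (r * u - y) =
      2 * r * c - (4 * y - 2 * r * (u + u - c)) by push_cast; ring] at this

theorem CoveredByArcs.exists_mul_circNorm_le [NeZero N] {r : ZMod N} {m : ℕ} {ℓ : ℝ}
    {U : Finset (ZMod N)} (h : CoveredByArcs r m ℓ U) (hℓ : 200 ^ m * ℓ ≤ N / 200) :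
    ∃ q : ℕ, 0 < q ∧ q ≤ 200 ^ m ∧ ∀ u ∈ U, 100 * circNorm ((q : ZMod N) * r * u) ≤ N := by
  obtain ⟨X, hX, hc⟩ := h
  obtain ⟨q, hq0, hq, hqX⟩ := _root_.exists_mul_circNorm_le X (M := 200) (by norm_num)
  have hq' : q ≤ 200 ^ m := hq.trans (Nat.pow_le_pow_right (by norm_num) hX)
  refine ⟨q, hq0, hq', fun u hu => ?_⟩
  obtain ⟨x, hx, hle⟩ := hc u hu
  have h1 := hqX x hx
  have h2 : circNorm ((q : ZMod N) * r * u) ≤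
      q * circNorm (r * u - x) + circNorm ((q : ZMod N) * x) := by
    rw [show (q : ZMod N) * r * u = q * (r * u - x) + q * x by ring]
    exact (circNorm_add_le _ _).trans (Nat.add_le_add_right (circNorm_natCast_mul_le _ _) _)
  have h1' : (200 : ℝ) * circNorm ((q : ZMod N) * x) ≤ N := by exact_mod_cast h1
  have h2' : (circNorm ((q : ZMod N) * r * u) : ℝ) ≤
      q * circNorm (r * u - x) + circNorm ((q : ZMod N) * x) := by exact_mod_cast h2
  have h3 : (q : ℝ) * circNorm (r * u - x) ≤ 200 ^ m * ℓ := by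
    have : (q : ℝ) ≤ 200 ^ m := by exact_mod_cast hq'
    exact mul_le_mul this hle (by positivity) (by positivity)
  have h4 : (100 : ℝ) * circNorm ((q : ZMod N) * r * u) ≤ N := by linarith
  exact_mod_cast h4

/-- Iterating the growth step: each round adds at least `#A / 20000` elements unless 99% of `A` is
already covered. -/
theorem exists_covered_subset (h2 : Function.Injective fun x : ZMod N => x + x)
    {A U : Finset (ZMod N)} (hU : U ⊆ A) (hA : #A ^ 2 ≤ 2 * T3 A) (h3 : 3 ≤ #A)
    (hU0 : #A ≤ 12 * #U) (hsub : ∀ B ⊂ A, T3 B ≤ (#B ^ 2 + 1) / 2) {r : ZMod N} {m : ℕ} {ℓ : ℝ}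
    (hcov : CoveredByArcs r m ℓ U) (j : ℕ) :
    ∃ V ⊆ A, CoveredByArcs (2 ^ j * r) (2 ^ j * m) (4 ^ j * ℓ) V ∧ #A ≤ 12 * #V ∧
      (100 * #(A \ V) ≤ #A ∨ #A * j ≤ 20000 * #V) := by
  induction j with
  | zero => exact ⟨U, hU, by simpa using hcov, hU0, Or.inr (by simp)⟩
  | succ j ih =>
    obtain ⟨V, hV, hc, hV0, h⟩ := ih
    have e1 : 2 ^ (j + 1) * r = 2 * (2 ^ j * r) := by ring
    have e2 : 2 ^ (j + 1) * m = 2 * (2 ^ j * m) := by ring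
    have e3 : 4 ^ (j + 1) * ℓ = 4 * (4 ^ j * ℓ) := by ring
    rw [e1, e2, e3]
    by_cases hlt : 100 * #(A \ V) ≤ #A
    · have := hc.union_affine_copy (P := ∅) (x := 0) (Or.inl (by simp))
      rw [union_empty] at this
      exact ⟨V, hV, this, hV0, Or.inl hlt⟩
    · obtain ⟨P, hP, hPc, x, hx⟩ :=
        exists_subset_affine_copy h2 hV hA h3 hV0 (not_le.1 hlt) hsub
      have hcard : #(V ∪ P) = #V + #P := card_union_of_disjoint
        (disjoint_of_subset_right hP disjoint_sdiff)
      refine ⟨V ∪ P, union_subset hV (hP.trans sdiff_subset), hc.union_affine_copy hx, by omega,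
        Or.inr ?_⟩
      rw [hcard, mul_add, mul_add, mul_one]
      have := h.resolve_left hlt
      omega

theorem zmod_add_self_injective [Fact N.Prime] (h : N ≠ 2) :
    Function.Injective fun x : ZMod N => x + x := by
  intro x y hxy
  simp only [← two_mul] at hxy
  refine mul_left_cancel₀ ?_ hxy
  have := Fact.out (p := N.Prime)
  intro h0
  have h1 : ((2 : ℕ) : ZMod N) = 0 := by exact_mod_cast h0
  rw [ZMod.natCast_eq_zero_iff] at h1
  exact h ((Nat.prime_dvd_prime_iff_eq this Nat.prime_two).1 h1)

/-- A sparse set with many progressions, no proper subset of which beats the bound, is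
concentrated on a short arc after a dilation. -/
theorem exists_concentrated : ∃ c : ℝ, 0 < c ∧ c < 1 / 200 ∧ ∀ (N : ℕ) [Fact N.Prime]
    (A : Finset (ZMod N)), A.Nonempty → (#A : ℝ) ≤ c * N → #A ^ 2 ≤ 2 * T3 A →
    (∀ B ⊂ A, T3 B ≤ (#B ^ 2 + 1) / 2) →
    ∃ R : ZMod N, R ≠ 0 ∧ 100 * #{a ∈ A | ¬ 100 * circNorm (R * a) ≤ N} ≤ #A := by
  -- One round more than 20000: a set that gained `#A / 20000` elements in each of `J` rounds would
  -- be larger than `A`.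
  obtain ⟨J, hJ⟩ : ∃ J : ℕ, J = 20001 := ⟨_, rfl⟩
  obtain ⟨Q, hQ⟩ : ∃ Q : ℕ, Q = 200 ^ 2 ^ J := ⟨_, rfl⟩
  have hQ200 : 200 ≤ Q := by
    rw [hQ]
    exact Nat.le_self_pow (by positivity) 200
  have hQpos : (0 : ℝ) < Q := by positivity
  -- After `J` rounds the radius is `4 ^ J * τ * N`, and the Dirichlet multiplier `q ≤ Q` may
  -- enlarge it by `Q`; the result is exactly `N / 200`.
  obtain ⟨τ, hτ⟩ : ∃ τ : ℝ, τ = 1 / (200 * (Q * 4 ^ J)) := ⟨_, rfl⟩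
  have hτ0 : 0 < τ := by rw [hτ]; positivity
  have hτ1 : τ < 1 / 2 := by
    rw [hτ, one_div_lt_one_div (by positivity) (by norm_num)]
    have : (1 : ℝ) ≤ 4 ^ J := one_le_pow₀ (by norm_num)
    have : (200 : ℝ) ≤ Q := by exact_mod_cast hQ200
    nlinarith
  have hτsq : 0 < 1 - 4 * τ ^ 2 := by nlinarith
  have hτsq' : 1 - 4 * τ ^ 2 < 1 := by nlinarith
  -- `147456 = 6 * 24576`, from `#(B - B) ≤ 24576 * #A` and `#A ≤ 6 * #B`.
  obtain ⟨c, hc0, hc⟩ := exists_norm_expSum_ge 147456 (Real.sqrt_pos.2 hτsq)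
    (by rw [Real.sqrt_lt' one_pos, one_pow]; exact hτsq')
  refine ⟨min c (1 / (Q + 1)), by positivity, ?_, fun N _ A hne hcard hA hsub => ?_⟩
  · refine (min_le_right _ _).trans_lt ?_
    rw [one_div_lt_one_div (by positivity) (by norm_num)]
    have : (200 : ℝ) ≤ Q := by exact_mod_cast hQ200
    linarith
  have hNpos : (0 : ℝ) < N := by exact_mod_cast NeZero.pos N
  have hn : 0 < #A := hne.card_pos
  -- This makes the multiplier `q ≤ Q` nonzero modulo `N`.
  have hQN : Q < N := by
    have h1 : (1 : ℝ) ≤ #A := by exact_mod_cast hn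
    have h2 : (#A : ℝ) ≤ 1 / (Q + 1) * N :=
      hcard.trans (mul_le_mul_of_nonneg_right (min_le_right _ _) hNpos.le)
    rw [one_div, inv_mul_eq_div, le_div_iff₀ (by positivity)] at h2
    have : (Q : ℝ) < N := by nlinarith
    exact_mod_cast this
  have hN2 : N ≠ 2 := by omega
  have h2 := zmod_add_self_injective hN2
  have h20 : (2 : ZMod N) ≠ 0 := fun h => by
    have := @h2 1 0 (by simp only; rw [one_add_one_eq_two, h, add_zero])
    exact one_ne_zero this
  obtain ⟨V, hVA, r, hr, hcov, hV⟩ : ∃ V ⊆ A, ∃ r : ZMod N, r ≠ 0 ∧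
      CoveredByArcs r (2 ^ J) (4 ^ J * (τ * N)) V ∧ 100 * #(A \ V) ≤ #A := by
    by_cases h3 : 3 ≤ #A
    swap
    · refine ⟨A, subset_rfl, 1, one_ne_zero, ⟨A, ?_, fun u hu => ⟨u, hu, ?_⟩⟩, by simp⟩
      · have : 2 ^ 1 ≤ 2 ^ J := Nat.pow_le_pow_right (by norm_num) (by omega)
        omega
      · rw [one_mul, sub_self, circNorm_zero, Nat.cast_zero]
        positivity
    obtain ⟨B, hBA, hB, hBB⟩ := exists_subset_card_sub_le h2 hne hA
    have hBne : B.Nonempty := card_pos.1 (by omega)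
    obtain ⟨r, hr, hr'⟩ := hc N B hBne (by omega) (by
      refine le_trans ?_ (hcard.trans (mul_le_mul_of_nonneg_right (min_le_left _ _) hNpos.le))
      exact_mod_cast card_le_card hBA)
    obtain ⟨x, hx⟩ := exists_arc_of_norm_expSum_ge hBne hτ0 (Real.sqrt_nonneg _)
      (by rw [Real.sq_sqrt hτsq.le]) hr'
    obtain ⟨V, hVA, hVc, hV0, hV⟩ := exists_covered_subset h2
      ((filter_subset (fun b => (circNorm (r * b - x) : ℝ) ≤ τ * N) B).trans hBA) hA h3
      (by omega) hsub (r := r) (m := 1) (ℓ := τ * N)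
      ⟨{x}, by simp, fun u hu => ⟨x, by simp, (mem_filter.1 hu).2⟩⟩ J
    rw [mul_one] at hVc
    refine ⟨V, hVA, _, mul_ne_zero (pow_ne_zero _ h20) hr, hVc, hV.resolve_right fun h => ?_⟩
    have := card_le_card hVA
    rw [hJ] at h
    omega
  obtain ⟨q, hq0, hq, hqV⟩ := hcov.exists_mul_circNorm_le (by
    have : (200 : ℝ) ^ 2 ^ J = Q := by rw [hQ]; push_cast; rfl
    rw [this, hτ]
    apply le_of_eq
    field_simp)
  rw [← hQ] at hq
  refine ⟨q * r, mul_ne_zero ?_ hr, le_trans (Nat.mul_le_mul_left _ (card_le_card ?_)) hV⟩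
  · rw [Ne, ZMod.natCast_eq_zero_iff]
    exact fun h => absurd (Nat.le_of_dvd hq0 h) (by omega)
  · intro a ha
    rw [mem_filter] at ha
    exact mem_sdiff.2 ⟨ha.1, fun h => ha.2 (hqV a h)⟩

end Concentration

/-! ### Removing the exceptional elements and lifting to the integers -/

section Rectification

theorem card_filter_mem_mem_le {α β : Type*} [DecidableEq β] {S : Finset α} (p q : α → β)
    (h : Set.InjOn (fun t => (p t, q t)) S) (D F : Finset β) :
    #{t ∈ S | p t ∈ D ∧ q t ∈ F} ≤ #D * #F := by
  rw [← card_product]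
  refine card_le_card_of_injOn (fun t => (p t, q t)) (fun t ht => ?_) (h.mono fun t ht => ?_)
  · simpa using (mem_filter.1 ht).2
  · exact (mem_filter.1 ht).1

/-- If every progression of `A` that meets `D` has a second element in `F`, then there are few such
progressions. -/
theorem T3_le_T3_sdiff_add {G : Type*} [AddCommGroup G] [DecidableEq G]
    (h2 : Function.Injective fun x : G => x + x) {A D F : Finset G}
    (hx : ∀ x ∈ D, ∀ y ∈ A, ∀ z ∈ A, x + z = y + y → y ∈ F ∨ z ∈ F)
    (hy : ∀ x ∈ A, ∀ y ∈ D, ∀ z ∈ A, x + z = y + y → x ∈ F ∨ z ∈ F) :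
    T3 A ≤ T3 (A \ D) + 6 * (#D * #F) := by
  simp only [T3_eq_card_apTriples]
  set S := apTriples A
  have e : S ⊆ apTriples (A \ D) ∪
      (({t ∈ S | t.1 ∈ D ∧ t.2.1 ∈ F} ∪ {t ∈ S | t.1 ∈ D ∧ t.2.2 ∈ F}) ∪
       ({t ∈ S | t.2.1 ∈ D ∧ t.1 ∈ F} ∪ {t ∈ S | t.2.1 ∈ D ∧ t.2.2 ∈ F}) ∪
       ({t ∈ S | t.2.2 ∈ D ∧ t.1 ∈ F} ∪ {t ∈ S | t.2.2 ∈ D ∧ t.2.1 ∈ F})) := by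
    rintro ⟨x, y, z⟩ ht
    obtain ⟨hxA, hyA, hzA, h⟩ := mem_apTriples.1 ht
    simp only [mem_union, mem_filter, ht, true_and, mem_apTriples, mem_sdiff, hxA, hyA, hzA, h,
      and_true]
    by_cases hxD : x ∈ D
    · have := hx x hxD y hyA z hzA h
      tauto
    by_cases hyD : y ∈ D
    · have := hy x hxA y hyD z hzA h
      tauto
    by_cases hzD : z ∈ D
    · have := hx z hzD y hyA x hxA (by rw [add_comm, h])
      tauto
    · tauto
  have key : ∀ t ∈ S, ∀ t' ∈ S, t.1 + t.2.2 = t.2.1 + t.2.1 ∧ t'.1 + t'.2.2 = t'.2.1 + t'.2.1 :=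
    fun t ht t' ht' => ⟨(mem_filter.1 ht).2, (mem_filter.1 ht').2⟩
  have i12 : Set.InjOn (fun t : G × G × G => (t.1, t.2.1)) S := by
    rintro ⟨x, y, z⟩ ht ⟨x', y', z'⟩ ht' h
    obtain ⟨e1, e2⟩ := key _ ht _ ht'
    simp only [Prod.mk.injEq] at h e1 e2 ⊢
    obtain ⟨rfl, rfl⟩ := h
    exact ⟨rfl, rfl, add_left_cancel (e1.trans e2.symm)⟩
  have i13 : Set.InjOn (fun t : G × G × G => (t.1, t.2.2)) S := by
    rintro ⟨x, y, z⟩ ht ⟨x', y', z'⟩ ht' h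
    obtain ⟨e1, e2⟩ := key _ ht _ ht'
    simp only [Prod.mk.injEq] at h e1 e2 ⊢
    obtain ⟨rfl, rfl⟩ := h
    exact ⟨rfl, h2 (e1.symm.trans e2), rfl⟩
  have i23 : Set.InjOn (fun t : G × G × G => (t.2.1, t.2.2)) S := by
    rintro ⟨x, y, z⟩ ht ⟨x', y', z'⟩ ht' h
    obtain ⟨e1, e2⟩ := key _ ht _ ht'
    simp only [Prod.mk.injEq] at h e1 e2 ⊢
    obtain ⟨rfl, rfl⟩ := h
    exact ⟨add_right_cancel (e1.trans e2.symm), rfl, rfl⟩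
  have hswap : ∀ {p q : G × G × G → G}, Set.InjOn (fun t => (p t, q t)) S →
      Set.InjOn (fun t => (q t, p t)) S := by
    intro p q h t ht t' ht' h'
    simp only [Prod.mk.injEq] at h'
    exact h ht ht' (Prod.ext h'.2 h'.1)
  have c1 := card_filter_mem_mem_le _ _ i12 D F
  have c2 := card_filter_mem_mem_le _ _ i13 D F
  have c3 := card_filter_mem_mem_le _ _ (hswap i12) D F
  have c4 := card_filter_mem_mem_le _ _ i23 D F
  have c5 := card_filter_mem_mem_le _ _ (hswap i13) D F
  have c6 := card_filter_mem_mem_le _ _ (hswap i23) D F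
  have hle := (card_le_card e).trans ((card_union_le _ _).trans (Nat.add_le_add_left
    ((card_union_le _ _).trans (Nat.add_le_add ((card_union_le _ _).trans (Nat.add_le_add
      (card_union_le _ _) (card_union_le _ _))) (card_union_le _ _))) _))
  omega

variable {N : ℕ} [Fact N.Prime]

/-- A concentrated set with many progressions lies on a short arc after a dilation. -/
theorem exists_dilate_subset_arc (hN : N ≠ 2) {A : Finset (ZMod N)}
    (hA : #A ^ 2 ≤ 2 * T3 A) (hsub : ∀ B ⊂ A, T3 B ≤ (#B ^ 2 + 1) / 2) {R : ZMod N} (hR : R ≠ 0)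
    (hconc : 100 * #{a ∈ A | ¬ 100 * circNorm (R * a) ≤ N} ≤ #A) :
    ∃ R' : ZMod N, R' ≠ 0 ∧ ∀ a ∈ A, 4 * circNorm (R' * a) < N := by
  have h2 := zmod_add_self_injective hN
  have h20 : (2 : ZMod N) ≠ 0 := fun h => by
    have := @h2 1 0 (by simp only; rw [one_add_one_eq_two, h, add_zero])
    exact one_ne_zero this
  have hNpos : 0 < N := NeZero.pos N
  set F := {a ∈ A | ¬ 100 * circNorm (R * a) ≤ N} with hF
  -- If two terms of a progression are within `N / 100` of zero after dilation by `R`, the third is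
  -- within `6N / 100` after dilation by `2R`: an end satisfies `2x = 4y - 2z`, a middle `2y = x +
  -- z`. Hence a progression through `D` has another term in `F`.
  set D := {a ∈ A | ¬ 100 * circNorm (2 * R * a) ≤ 6 * N} with hD
  have hcomb : ∀ (p q : ℕ) (a b c : ZMod N), a = p * b + q * c →
      circNorm a ≤ p * circNorm b + q * circNorm c := by
    rintro p q a b c rfl
    exact (circNorm_add_le _ _).trans (Nat.add_le_add (circNorm_natCast_mul_le _ _)
      (circNorm_natCast_mul_le _ _))
  have hgood : ∀ a ∈ A, a ∉ F → 100 * circNorm (R * a) ≤ N := by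
    intro a ha h
    by_contra hlt
    exact h (mem_filter.2 ⟨ha, hlt⟩)
  have hDF : D ⊆ F := by
    intro a ha
    rw [hD, mem_filter] at ha
    by_contra h
    have h1 := hgood a ha.1 h
    have h3 := hcomb 2 0 (2 * R * a) (R * a) 0 (by push_cast; ring)
    omega
  have hT := T3_le_T3_sdiff_add h2 (A := A) (D := D) (F := F)
    (by
      intro x hx y hy z hz e
      by_contra! hcon
      have h1 := hgood y hy hcon.1
      have h3 := hgood z hz hcon.2
      have h4 := hcomb 4 2 (2 * R * x) (R * y) (-(R * z)) (by
        push_cast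
        linear_combination 2 * R * e)
      rw [circNorm_neg] at h4
      have := (mem_filter.1 hx).2
      omega)
    (by
      intro x hx y hy z hz e
      by_contra! hcon
      have h1 := hgood x hx hcon.1
      have h3 := hgood z hz hcon.2
      have h4 := hcomb 1 1 (2 * R * y) (R * x) (R * z) (by
        push_cast
        linear_combination -R * e)
      have := (mem_filter.1 hy).2
      omega)
  refine ⟨2 * R, mul_ne_zero h20 hR, fun a ha => ?_⟩
  by_contra hlt
  have haD : a ∈ D := mem_filter.2 ⟨ha, by omega⟩
  have ht : 0 < #D := card_pos.2 ⟨a, haD⟩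
  have htf := card_le_card hDF
  have hDA : D ⊆ A := filter_subset _ _
  have hcard := card_sdiff_add_card_eq_card hDA
  have h1 := hsub (A \ D) (ssubset_of_subset_of_ne sdiff_subset (fun h => by
    have := congrArg card h
    omega))
  set t := #D
  set f := #F
  set u := #(A \ D)
  have h3 : 2 * T3 (A \ D) ≤ u ^ 2 + 1 := by omega
  rw [← hcard] at hA hconc
  -- Deleting `D` lowers twice the bound by about `2ut + t²`, but loses progressions worth at most
  -- `12tf ≤ 0.12 * t * (u + t)`; so `D` must be empty.
  have h4 : 12 * (t * f) * 100 ≤ 12 * (t * (u + t)) := by nlinarith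
  have h5 : t * t ≥ 1 := Nat.mul_pos ht ht
  have h6 : 99 * t ≤ u := by omega
  nlinarith

theorem intCast_eq_intCast_of_natAbs_lt {i j : ℤ} (h : (i : ZMod N) = j)
    (hlt : (i - j).natAbs < N) : i = j := by
  rw [← sub_eq_zero, ← Int.cast_sub, ZMod.intCast_zmod_eq_zero_iff_dvd] at h
  have := Int.eq_zero_of_abs_lt_dvd h (by rw [Int.abs_eq_natAbs]; exact_mod_cast hlt)
  omega

/-- A set of residues on a short arc is isomorphic to a set of integers. -/
theorem exists_int_model {A : Finset (ZMod N)} {R : ZMod N} (hR : R ≠ 0)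
    (hA : ∀ a ∈ A, 4 * circNorm (R * a) < N) :
    ∃ S : Finset ℤ, #S = #A ∧ T3 S = T3 A ∧ (∀ s ∈ S, 4 * s.natAbs < N) ∧
      A = S.image fun s : ℤ => R⁻¹ * (s : ZMod N) := by
  have hinj : Set.InjOn (fun a => (R * a).valMinAbs) (A : Set (ZMod N)) := fun a _ b _ h =>
    mul_left_cancel₀ hR (ZMod.injective_valMinAbs h)
  refine ⟨A.image fun a => (R * a).valMinAbs, card_image_of_injOn hinj,
    T3_image_of_freiman hinj ?_, ?_, ?_⟩
  · intro x hx y hy z hz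
    constructor
    · intro h
      have := congrArg (Int.cast : ℤ → ZMod N) h
      push_cast [ZMod.coe_valMinAbs] at this
      rw [← mul_add, ← mul_add] at this
      exact mul_left_cancel₀ hR this
    · intro h
      apply intCast_eq_intCast_of_natAbs_lt (N := N)
      · push_cast [ZMod.coe_valMinAbs]
        rw [← mul_add, ← mul_add, h]
      · have h1 := hA x hx
        have h2 := hA y hy
        have h3 := hA z hz
        unfold circNorm at h1 h2 h3
        omega
  · intro s hs
    obtain ⟨a, ha, rfl⟩ := mem_image.1 hs
    exact hA a ha
  · rw [image_image]
    ext x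
    simp only [mem_image, Function.comp_apply, ZMod.coe_valMinAbs]
    constructor
    · exact fun hx => ⟨x, hx, by rw [inv_mul_cancel_left₀ hR]⟩
    · rintro ⟨a, ha, rfl⟩
      rwa [inv_mul_cancel_left₀ hR]

theorem isAffineImage_of_int_model {A : Finset (ZMod N)} {R : ZMod N} (hR : R ≠ 0)
    {S E : Finset ℤ} (hcard : 2 ≤ #S) (hS : ∀ s ∈ S, 4 * s.natAbs < N)
    (hA : A = S.image fun s : ℤ => R⁻¹ * (s : ZMod N)) {a b : ℤ}
    (hSE : S = E.image fun x => a * x + b) : IsAffineImage A E := by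
  -- If `N` divided `a`, two distinct elements of `S` would agree modulo `N` although they differ by
  -- less than `N / 2`.
  have ha : (a : ZMod N) ≠ 0 := by
    intro h0
    obtain ⟨s, hs, t, ht, hne⟩ := one_lt_card.1 hcard
    apply hne
    have hs' := hS s hs
    have ht' := hS t ht
    rw [hSE] at hs ht
    obtain ⟨x, -, rfl⟩ := mem_image.1 hs
    obtain ⟨y, -, rfl⟩ := mem_image.1 ht
    apply intCast_eq_intCast_of_natAbs_lt (N := N)
    · push_cast
      rw [h0, zero_mul, zero_mul]
    · omega
  refine ⟨R⁻¹ * a, R⁻¹ * b, (mul_ne_zero (inv_ne_zero hR) ha).isUnit, ?_⟩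
  rw [hA, hSE, image_image]
  refine image_congr fun x _ => ?_
  simp only [Function.comp_apply]
  push_cast
  ring

theorem card_T3_affine_image {S : Finset ℤ} {L : ℕ} (hL : 4 * L < N)
    (hS : ∀ s ∈ S, s.natAbs ≤ L) {a : ZMod N} (ha : a ≠ 0) (b : ZMod N) :
    #(S.image fun x : ℤ => a * (x : ZMod N) + b) = #S ∧
      T3 (S.image fun x : ℤ => a * (x : ZMod N) + b) = T3 S := by
  have e : (S.image fun x : ℤ => a * (x : ZMod N) + b) =
      (S.image (Int.cast : ℤ → ZMod N)).image fun x => a * x + b := by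
    rw [image_image]
    rfl
  have hinj : Set.InjOn (Int.cast : ℤ → ZMod N) (S : Set ℤ) := fun x hx y hy h => by
    have h1 := hS x hx
    have h2 := hS y hy
    exact intCast_eq_intCast_of_natAbs_lt h (by omega)
  rw [e, card_image_affine _ ha, T3_image_affine _ ha]
  refine ⟨card_image_of_injOn hinj, T3_image_of_freiman hinj fun x hx y hy z hz =>
    ⟨fun h => ?_, fun h => by exact_mod_cast congrArg (Int.cast : ℤ → ZMod N) h⟩⟩
  have h1 := hS x hx
  have h2 := hS y hy
  have h3 := hS z hz
  exact intCast_eq_intCast_of_natAbs_lt (N := N) (by exact_mod_cast h) (by omega)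

theorem natAbs_le_of_mem_extremalE {k m : ℕ} {x : ℤ} (h : x ∈ extremalE k m) :
    x.natAbs ≤ k + 2 * m := by
  rw [mem_extremalE] at h
  omega

/-- Sparse affine images of the extremal sets have the largest number of progressions. -/
theorem T3_eq_of_isAffineImage {A : Finset (ZMod N)} (hA : 200 * #A < N) {k m : ℕ}
    {E : Finset ℤ} (hE : E = extremalE k m ∨ E = extremalF k m) (h : IsAffineImage A E) :
    T3 A = (#A ^ 2 + 1) / 2 := by
  rcases A.eq_empty_or_nonempty with rfl | hne
  · have := T3_le (∅ : Finset (ZMod N))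
    simpa using this
  have hpos := hne.card_pos
  have h2 := zmod_add_self_injective (N := N) (by omega)
  obtain ⟨a, b, ha, rfl⟩ := h
  have hFE : extremalF k m ⊆ E := by
    rcases hE with rfl | rfl
    · exact erase_subset _ _
    · exact subset_rfl
  have hEE : E ⊆ extremalE k m := by
    rcases hE with rfl | rfl
    · exact subset_rfl
    · exact erase_subset _ _
  -- The model is not assumed short, so wrapping around must be excluded. A long model contains a
  -- progression of step two with `N / 4` terms, distinct modulo the odd prime `N`, too many for the
  -- sparse set.
  have hkm : 4 * (k + 2 * m) < N := by
    by_contra hlt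
    have h1 : #(Icc 1 (N / 4)) ≤ #(E.image fun x : ℤ => a * (x : ZMod N) + b) := by
      refine card_le_card_of_injOn
        (fun i : ℕ => a * ((-(k : ℤ) - 2 * m + 2 * i : ℤ) : ZMod N) + b) (fun i hi => ?_) ?_
      · simp only [coe_Icc, Set.mem_Icc] at hi
        refine mem_image_of_mem (fun x : ℤ => a * (x : ZMod N) + b) (hFE ?_)
        rw [mem_extremalF]
        omega
      · intro i hi j hj hij
        simp only [coe_Icc, Set.mem_Icc] at hi hj
        simp only [add_left_inj] at hij
        have h3 := ha.mul_left_cancel hij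
        push_cast at h3
        have h4 : ((i : ℤ) : ZMod N) = ((j : ℤ) : ZMod N) := by
          apply h2
          push_cast
          linear_combination h3
        have := intCast_eq_intCast_of_natAbs_lt h4 (by omega)
        exact_mod_cast this
    rw [Nat.card_Icc] at h1
    omega
  obtain ⟨h1, h3⟩ := card_T3_affine_image hkm
    (fun s hs => natAbs_le_of_mem_extremalE (hEE hs)) ha.ne_zero b
  rw [h1, h3]
  rcases hE with rfl | rfl
  · exact T3_extremalE k m
  · exact T3_extremalF k m

end Rectification

/-! ### The induction and the theorem -/

section Main

/-- The bound on the number of progressions in a sparse set of residues, and the cases of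
equality. -/
theorem exists_T3_zmod_le : ∃ c : ℝ, 0 < c ∧ c < 1 / 200 ∧ ∀ (N : ℕ) [Fact N.Prime]
    (A : Finset (ZMod N)), (#A : ℝ) ≤ c * N → T3 A ≤ (#A ^ 2 + 1) / 2 ∧
      (T3 A = (#A ^ 2 + 1) / 2 →
        ∃ k m : ℕ, IsAffineImage A (extremalE k m) ∨ IsAffineImage A (extremalF k m)) := by
  obtain ⟨c, hc0, hc1, hc⟩ := exists_concentrated
  refine ⟨c, hc0, hc1, fun N _ A => ?_⟩
  induction A using Finset.strongInduction with
  | H A ih =>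
    intro hcard
    rcases A.eq_empty_or_nonempty with rfl | hne
    · refine ⟨(T3_le _).trans (by simp), fun _ => ⟨0, 0, Or.inr ⟨1, 0, isUnit_one, ?_⟩⟩⟩
      rw [eq_comm, image_eq_empty]
      ext x
      simp only [mem_extremalF, notMem_empty, iff_false]
      omega
    -- If `2 * T3 A < #A ^ 2`, the bound holds strictly and no case of equality arises.
    by_cases hA : #A ^ 2 ≤ 2 * T3 A
    swap
    · exact ⟨by omega, fun h => by omega⟩
    have hsub : ∀ B ⊂ A, T3 B ≤ (#B ^ 2 + 1) / 2 := fun B hB => (ih B hB (by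
      refine le_trans ?_ hcard
      exact_mod_cast (card_lt_card hB).le)).1
    have hN : N ≠ 2 := by
      rintro rfl
      have : (1 : ℝ) ≤ #A := by exact_mod_cast hne.card_pos
      push_cast at hcard
      linarith
    obtain ⟨R, hR, hconc⟩ := hc N A hne hcard hA hsub
    obtain ⟨R', hR', harc⟩ := exists_dilate_subset_arc hN hA hsub hR hconc
    obtain ⟨S, hS, hST, hSN, hAS⟩ := exists_int_model hR' harc
    rw [← hS, ← hST]
    refine ⟨T3_int_le S, fun h => ?_⟩
    by_cases hS2 : 2 ≤ #S
    · obtain ⟨k, m, a, b, -, h⟩ := exists_image_extremal_of_T3_eq h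
      exact ⟨k, m, h.imp (isAffineImage_of_int_model hR' hS2 hSN hAS)
        (isAffineImage_of_int_model hR' hS2 hSN hAS)⟩
    -- For a single point the integer dilation factor may vanish modulo `N`, so the affine image is
    -- given directly.
    · have hpos := hne.card_pos
      obtain ⟨x, rfl⟩ := card_eq_one.1 (show #A = 1 by omega)
      refine ⟨0, 0, Or.inl ⟨1, x, isUnit_one, ?_⟩⟩
      have : extremalE 0 0 = {0} := by
        ext y
        simp only [mem_extremalE, mem_singleton]
        omega
      rw [this, image_singleton]
      simp

theorem exists_extremal_card_eq (n : ℕ) : ∃ k : ℕ, 2 * k ≤ n ∧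
    (#(extremalE k 0) = n ∨ #(extremalF k 0) = n) := by
  have hE : ∀ k : ℕ, extremalE k 0 = Icc (-(k : ℤ)) k := by
    intro k
    ext x
    simp only [mem_extremalE, mem_Icc]
    omega
  have hcard : ∀ k : ℕ, #(extremalE k 0) = 2 * k + 1 := by
    intro k
    rw [hE, Int.card_Icc]
    omega
  obtain ⟨k, rfl | rfl⟩ := Nat.even_or_odd' n
  · refine ⟨k, le_rfl, Or.inr ?_⟩
    rw [extremalF, card_erase_of_mem, hcard]
    · rfl
    · rw [mem_extremalE]
      omega
  · exact ⟨k, by omega, Or.inl (hcard k)⟩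

theorem natCeil_sq_div_two (n : ℕ) : ⌈((n : ℝ) ^ 2 / 2)⌉₊ = (n ^ 2 + 1) / 2 := by
  have h : ((n : ℝ) ^ 2) = ((n ^ 2 : ℕ) : ℝ) := by push_cast; rfl
  rw [h]
  generalize n ^ 2 = t
  apply le_antisymm
  · rw [Nat.ceil_le, div_le_iff₀ two_pos]
    have : t ≤ (t + 1) / 2 * 2 := by omega
    exact_mod_cast this
  · have h1 := Nat.le_ceil ((t : ℝ) / 2)
    rw [div_le_iff₀ two_pos] at h1
    have : t ≤ ⌈(t : ℝ) / 2⌉₊ * 2 := by exact_mod_cast h1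
    omega

theorem M3_eq_of_isGreatest {G : Type*} [AddCommGroup G] {n t : ℕ}
    (hle : ∀ A : Finset G, #A = n → T3 A ≤ t) (hex : ∃ A : Finset G, #A = n ∧ T3 A = t) :
    M3 G n = t := by
  obtain ⟨A, hA, hAt⟩ := hex
  have h := M3_isGreatest ⟨A, hA⟩
  obtain ⟨B, hB, hBt⟩ := h.1
  exact le_antisymm (hBt ▸ hle B hB) (hAt ▸ h.2 ⟨A, hA, rfl⟩)

end Main

theorem theorem1p5 :
    ∃ c : ℝ, 0 < c ∧ ∀ n N : ℕ, N.Prime → (n : ℝ) ≤ c * (N : ℝ) →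
      M3 (ZMod N) n = M3 ℤ n ∧
      M3 ℤ n = ⌈((n : ℝ) ^ 2 / 2)⌉₊ ∧
      ∀ A : Finset (ZMod N), A.card = n →
        (T3 A = M3 (ZMod N) n ↔
          ∃ k m : ℕ, IsAffineImage A (extremalE k m) ∨ IsAffineImage A (extremalF k m)) := by
  obtain ⟨c, hc0, hc1, hc⟩ := exists_T3_zmod_le
  refine ⟨c, hc0, fun n N hN hn => ?_⟩
  have : Fact N.Prime := ⟨hN⟩
  have hN0 : (0 : ℝ) < N := by exact_mod_cast hN.pos
  have hn200 : 200 * n < N := by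
    have : (200 : ℝ) * n < N := by nlinarith
    exact_mod_cast this
  have hle : ∀ A : Finset (ZMod N), #A = n → T3 A ≤ (n ^ 2 + 1) / 2 := by
    rintro A rfl
    exact (hc N A hn).1
  obtain ⟨k, hk, hkn⟩ := exists_extremal_card_eq n
  obtain ⟨E, hE, hEn, hET⟩ : ∃ E : Finset ℤ, (∀ s ∈ E, s.natAbs ≤ k) ∧ #E = n ∧
      T3 E = (n ^ 2 + 1) / 2 := by
    rcases hkn with rfl | rfl
    · exact ⟨_, fun s hs => natAbs_le_of_mem_extremalE hs, rfl, T3_extremalE k 0⟩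
    · exact ⟨_, fun s hs => natAbs_le_of_mem_extremalE (erase_subset _ _ hs), rfl,
        T3_extremalF k 0⟩
  have hZ : M3 ℤ n = (n ^ 2 + 1) / 2 :=
    M3_eq_of_isGreatest (fun A hA => hA ▸ T3_int_le A) ⟨E, hEn, hET⟩
  have hZN : M3 (ZMod N) n = (n ^ 2 + 1) / 2 := by
    obtain ⟨h1, h2⟩ := card_T3_affine_image (N := N) (L := k) (by omega) hE one_ne_zero 0
    exact M3_eq_of_isGreatest hle ⟨_, h1.trans hEn, h2.trans hET⟩
  refine ⟨hZN.trans hZ.symm, hZ.trans (natCeil_sq_div_two n).symm, fun A hA => ?_⟩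
  rw [hZN]
  subst hA
  constructor
  · exact (hc N A hn).2
  · rintro ⟨k, m, h | h⟩
    · exact T3_eq_of_isAffineImage hn200 (Or.inl rfl) h
    · exact T3_eq_of_isAffineImage hn200 (Or.inr rfl) h
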